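/- Let $f$ be a Riemann-integrable non-negative function on $[0,1]^2$ such that, for almost every $t\in[0,1]$, $f$ (as a function on $[0,1]^2$) is continuous at $(0,t)$ and $s\mapsto f(s,1)$ (as a function on $[0,1]$) is continuous at $t$. Let $k\ge 2$ be an integer and $\gamma = 1-\frac1k$. For $n\in\mathbb N$ let $G(n,f,\gamma)$ be the random directed graph with vertex set $\{1,\dots,n\}$ in which, for all $i<j$, the edge $(i,j)$ is present with probability $f(i/n,j/n)/n^{\gamma}$ (a number in $[0,1]$ for all large $n$; it is replaced by $1$ when larger than $1$), independently of all other edges. Let $L_n$ be the number of edges of a shortest directed path from $1$ to $n$ in $G(n,f,\gamma)$ ($L_n=\infty$ if there is none). For $m\ge 1$ put $$c_m(f)=\int_{0<u_1<\dots<u_{m-1}<1}\ \prod_{j=0}^{m-1} f(u_j,u_{j+1})\,du_1\cdots du_{m-1},\qquad u_0=0,\ u_m=1 .$$ Then the integral defining $c_k(f)$ converges absolutely (so $c_k(f)\in[0,\infty)$), and $$\lim_{n\to\infty}\mathbb P(L_n=k)=1-\exp(-c_k(f)).$$ If moreover $c_{k+1}(f)>0$, then also $$\lim_{n\to\infty}\mathbb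 P(L_n=k+1)=\exp(-c_k(f)).$$ The condition $c_{k+1}(f)>0$ holds whenever $f(x,y)>0$ for all $0\le x<y\le 1$. -/

import Mathlib

open MeasureTheory ProbabilityTheory Filter Topology

noncomputable section

namespace BarakErdos

/-- The unit box with corners `0` and `1` in `ℝ²`; its closed version is `[0,1]²`. -/
def unitBox : BoxIntegral.Box (Fin 2) where
  lower := fun _ => 0
  upper := fun _ => 1
  lower_lt_upper := fun _ => one_pos

/-- `f` is (properly) Riemann integrable on `[0,1]²`: the Riemann sums over tagged partitions of
the square into boxes, with tags in the closed boxes, converge as the mesh tends to zero. -/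
def RiemannIntegrable (f : ℝ → ℝ → ℝ) : Prop :=
  BoxIntegral.Integrable unitBox BoxIntegral.IntegrationParams.Riemann
    (fun x : Fin 2 → ℝ => f (x 0) (x 1)) BoxIntegral.BoxAdditiveMap.volume

/-- The sequence `(u₀, u₁, …, uₘ, uₘ₊₁)` with `u₀ = 0` and `uₘ₊₁ = 1`. -/
def addEnds {m : ℕ} (u : Fin m → ℝ) : Fin (m + 2) → ℝ :=
  Fin.cons (0 : ℝ) (Fin.snoc u (1 : ℝ) : Fin (m + 1) → ℝ)

/-- The open simplex `0 < u₁ < ⋯ < uₘ < 1`. -/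
def orderedSimplex (m : ℕ) : Set (Fin m → ℝ) :=
  {u | StrictMono (addEnds u)}

/-- The product `∏_{j=0}^{m} f(u_j, u_{j+1})`, where `u₀ = 0` and `uₘ₊₁ = 1`. -/
def pathProduct (f : ℝ → ℝ → ℝ) (m : ℕ) (u : Fin m → ℝ) : ℝ :=
  ∏ j : Fin (m + 1), f (addEnds u j.castSucc) (addEnds u j.succ)

/-- The constant `c_k(f) = ∫_{0 < u₁ < ⋯ < u_{k-1} < 1} ∏_{j=0}^{k-1} f(u_j, u_{j+1}) du`,
for `k ≥ 1`. -/
def pathIntegral (f : ℝ → ℝ → ℝ) (k : ℕ) : ℝ :=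
  ∫ u in orderedSimplex (k - 1), pathProduct f (k - 1) u

/-- The potential edges `(i, j)`, `1 ≤ i < j ≤ n`. -/
def edges (n : ℕ) : Finset (ℕ × ℕ) :=
  (Finset.Icc 1 n ×ˢ Finset.Icc 1 n).filter (fun e => e.1 < e.2)

/-- The probability `f(i/n, j/n) / n^γ` of presence of the edge `(i, j)`, truncated to `[0,1]`.
When `f` is bounded and non-negative and `γ > 0`, the truncation plays no role for large `n`. -/
def edgeProb (f : ℝ → ℝ → ℝ) (γ : ℝ) (n : ℕ) (e : ℕ × ℕ) : unitInterval :=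
  Set.projIcc (0 : ℝ) 1 zero_le_one (f ((e.1 : ℝ) / n) ((e.2 : ℝ) / n) / (n : ℝ) ^ γ)

/-- The law of the random graph `G(n, f, γ)`: the edges are present independently, `(i, j)` with
probability `edgeProb f γ n (i, j)`. -/
def graphLaw (f : ℝ → ℝ → ℝ) (γ : ℝ) (n : ℕ) : Measure (edges n → Bool) :=
  Measure.pi (fun e : edges n => bernoulliMeasure true false (edgeProb f γ n e.1))

/-- The directed graph with the edges selected by `ω`. Its vertices are `1, …, n`; all other
natural numbers are isolated. -/
def toDigraph {n : ℕ} (ω : edges n → Bool) : Digraph ℕ where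
  Adj i j := ∃ h : (i, j) ∈ edges n, ω ⟨(i, j), h⟩ = true

/-- There is a directed path with `m` edges from `a` to `b` in `G`. (In the graphs considered here
edges go from smaller to larger vertices, so the vertices along a path are distinct.) -/
def HasPath {V : Type*} (G : Digraph V) (a b : V) (m : ℕ) : Prop :=
  ∃ ρ : Fin (m + 1) → V, ρ 0 = a ∧ ρ (Fin.last m) = b ∧
    ∀ j : Fin m, G.Adj (ρ j.castSucc) (ρ j.succ)

/-- The length (number of edges) of the shortest directed path from `a` to `b` in `G`;
it is `⊤` when there is no such path. -/
def shortestPathLength {V : Type*} (G : Digraph V) (a b : V) : ℕ∞ :=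
  ⨅ (m : ℕ) (_ : HasPath G a b m), (m : ℕ∞)

/-- `P(L_n = m)`, where `L_n` is the length of the shortest path from `1` to `n`
in `G(n, f, γ)`. -/
def probLength (f : ℝ → ℝ → ℝ) (γ : ℝ) (n m : ℕ) : ℝ :=
  (graphLaw f γ n).real {ω | shortestPathLength (toDigraph ω) 1 n = (m : ℕ∞)}

end BarakErdos

end

noncomputable section

namespace BarakErdos

set_option linter.unusedSectionVars false

/-! ### Correlation, Janson and second-moment inequalities on finite Boolean product spaces -/

section ProductMeasures

variable {E : Type*} [Fintype E] [DecidableEq E] (ν : E → Measure Bool)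
  [∀ e, IsProbabilityMeasure (ν e)]

/-! The proof compares the number of paths of each fixed length with its mean. Put `t = n^(1/k)`, so
that `n^γ = n/t`. Up to a normalised Riemann sum tending to `c_m(f)`, the mean number of increasing
paths with `m` edges from `1` to `n` is `n^(m-1) (t/n)^m = t^m/n`. It tends to `0` for `m < k`
(first moment), converges to `c_k(f)` for `m = k` since `t^k = n`, and grows like `c_{k+1}(f) t` for
`m = k+1`.

The limits of the Riemann sums (`tendsto_sum_gridProduct`) follow by dominated convergence for step
functions on the grid. Riemann integrability makes `f` bounded and almost everywhere continuous,
which handles the inner edges of a path; the hypotheses on the sides of the square handle the first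
and last edges.

Dependence between paths comes only from shared edges. If a different path of the same length shares
`a ≥ 1` edges with a given one, at least `a` of its interior vertices are confined to the vertices
of the given path. With `q = M/n^γ` bounding every edge probability, the dependent pairs therefore
contribute at most a constant times `(n^d q^(d+1))²/(nq)` (`sum_sum_common_edge_le`), where `d + 1`
is the length and `nq = M t` tends to infinity.

For length `k` this contribution vanishes, and the probability of having no path is squeezed to
`exp(-c_k)`: `prod_le_noneOpen` (Harris) bounds it below, `janson` above. For length `k+1` the
contribution is `O(t)`, as large as the mean, so Janson's bound may be useless. Chebyshev
(`noneOpen_mul_sq_le`) still works, since a variance `O(t)` is negligible against a squared mean of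
order `t²`. Hence, with probability tending to one, `L_n` is `k` if there is a path of length `k`
and `k+1` otherwise. -/

lemma measurableSet_config (U : Set (E → Bool)) : MeasurableSet U :=
  (Set.toFinite U).measurableSet

lemma pi_real_singleton (ω : E → Bool) :
    (Measure.pi ν).real {ω} = ∏ e, (ν e).real {ω e} := by
  simp [measureReal_def, Measure.pi_singleton, ENNReal.toReal_prod]

lemma pi_real_eq_sum (U : Set (E → Bool)) :
    (Measure.pi ν).real U = ∑ ω, (Measure.pi ν).real {ω} * U.indicator (fun _ => (1 : ℝ)) ω := by
  classical
  have h := sum_measureReal_singleton (μ := Measure.pi ν) (U.toFinset)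
  simp only [Set.coe_toFinset] at h
  rw [← h, ← Finset.sum_subset (Finset.subset_univ U.toFinset)]
  · refine Finset.sum_congr rfl fun ω hω => ?_
    rw [Set.indicator_of_mem (by simpa using hω), mul_one]
  · intro ω _ hω
    rw [Set.indicator_of_notMem (by simpa using hω), mul_zero]

/-- **Harris' inequality** for two increasing events. -/
lemma harris_upper {U V : Set (E → Bool)} (hU : IsUpperSet U) (hV : IsUpperSet V) :
    (Measure.pi ν).real U * (Measure.pi ν).real V ≤ (Measure.pi ν).real (U ∩ V) := by
  have mono : ∀ {W : Set (E → Bool)}, IsUpperSet W →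
      Monotone (W.indicator (fun _ => (1 : ℝ))) := by
    intro W hW a b hab
    by_cases ha : a ∈ W
    · simp [ha, hW hab ha]
    · rw [Set.indicator_of_notMem ha]
      exact Set.indicator_nonneg (fun _ _ => zero_le_one) _
  -- For a product measure the lattice condition is an equality: in each coordinate, meet and join
  -- only reorder the two values.
  have hlog : ∀ a b : E → Bool, (Measure.pi ν).real {a} * (Measure.pi ν).real {b} ≤
      (Measure.pi ν).real {a ⊓ b} * (Measure.pi ν).real {a ⊔ b} := by
    intro a b
    simp only [pi_real_singleton, ← Finset.prod_mul_distrib]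
    refine le_of_eq (Finset.prod_congr rfl fun e _ => ?_)
    rw [Pi.inf_apply, Pi.sup_apply]
    cases a e <;> cases b e <;> simp [mul_comm]
  have h := fkg (μ := fun ω => (Measure.pi ν).real {ω}) (f := U.indicator (fun _ => (1 : ℝ)))
    (g := V.indicator (fun _ => (1 : ℝ))) (fun _ => measureReal_nonneg)
    (fun _ => Set.indicator_nonneg (fun _ _ => zero_le_one) _)
    (fun _ => Set.indicator_nonneg (fun _ _ => zero_le_one) _) (mono hU) (mono hV) hlog
  have h1 : ∑ ω, (Measure.pi ν).real {ω} = 1 := by simp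
  rw [h1, one_mul, ← pi_real_eq_sum, ← pi_real_eq_sum] at h
  refine h.trans_eq ?_
  rw [pi_real_eq_sum ν (U ∩ V)]
  refine Finset.sum_congr rfl fun ω _ => ?_
  by_cases h1 : ω ∈ U <;> by_cases h2 : ω ∈ V <;> simp [h1, h2]

/-- **Harris' inequality** for an increasing and a decreasing event. -/
lemma harris_upper_lower {U V : Set (E → Bool)} (hU : IsUpperSet U) (hV : IsLowerSet V) :
    (Measure.pi ν).real (U ∩ V) ≤ (Measure.pi ν).real U * (Measure.pi ν).real V := by
  have h := harris_upper ν hU hV.compl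
  rw [probReal_compl_eq_one_sub (measurableSet_config V)] at h
  have h2 := measureReal_inter_add_sdiff (μ := Measure.pi ν) (s := U) (measurableSet_config V)
  rw [Set.sdiff_eq] at h2
  linarith

/-- **Harris' inequality** for two decreasing events. -/
lemma harris_lower {U V : Set (E → Bool)} (hU : IsLowerSet U) (hV : IsLowerSet V) :
    (Measure.pi ν).real U * (Measure.pi ν).real V ≤ (Measure.pi ν).real (U ∩ V) := by
  have h := harris_upper_lower ν hU.compl hV
  rw [probReal_compl_eq_one_sub (measurableSet_config U)] at h
  have h2 := measureReal_inter_add_sdiff (μ := Measure.pi ν) (s := V) (measurableSet_config U)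
  rw [Set.sdiff_eq, Set.inter_comm V, Set.inter_comm V] at h2
  linarith

/-- All the elements of `S` are open. -/
def allOpen (S : Finset E) : Set (E → Bool) := {ω | ∀ e ∈ S, ω e = true}

/-- None of the sets `S i`, `i ∈ s`, is fully open. -/
def noneOpen {ι : Type*} (s : Finset ι) (S : ι → Finset E) : Set (E → Bool) :=
  {ω | ∀ i ∈ s, ω ∉ allOpen (S i)}

lemma isUpperSet_allOpen (S : Finset E) : IsUpperSet (allOpen S) := by
  intro a b hab ha e he
  have h1 := hab e
  rw [ha e he] at h1
  exact top_le_iff.1 h1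

lemma isLowerSet_noneOpen {ι : Type*} (s : Finset ι) (S : ι → Finset E) :
    IsLowerSet (noneOpen s S) := fun _ _ hab ha i hi hb =>
  ha i hi (isUpperSet_allOpen _ hab hb)

lemma allOpen_union (S T : Finset E) : allOpen (S ∪ T) = allOpen S ∩ allOpen T := by
  ext ω
  simp only [allOpen, Finset.mem_union, Set.mem_ofPred_eq, Set.mem_inter_iff]
  exact ⟨fun h => ⟨fun e he => h e (Or.inl he), fun e he => h e (Or.inr he)⟩,
    fun h e he => he.elim (h.1 e) (h.2 e)⟩

lemma pi_real_allOpen (S : Finset E) :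
    (Measure.pi ν).real (allOpen S) = ∏ e ∈ S, (ν e).real {true} := by
  have h : allOpen S = Set.univ.pi fun e => if e ∈ S then ({true} : Set Bool) else Set.univ := by
    ext ω
    simp only [allOpen, Set.mem_ofPred_eq, Set.mem_pi, Set.mem_univ, true_imp_iff]
    refine forall_congr' fun e => ?_
    split_ifs with h <;> simp [h]
  rw [h, measureReal_def, Measure.pi_pi, ENNReal.toReal_prod,
    ← Finset.prod_subset (Finset.subset_univ S)]
  · refine Finset.prod_congr rfl fun e he => ?_
    simp [he, measureReal_def]
  · intro e _ he
    simp only [he, if_false, measure_univ, ENNReal.toReal_one]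

/-- The two events depend on disjoint sets of coordinates, `T` and its complement. This is the only
independence that Janson's induction needs. -/
lemma pi_real_allOpen_inter_noneOpen {ι : Type*} (T : Finset E) (s : Finset ι)
    (S : ι → Finset E) (hS : ∀ i ∈ s, Disjoint T (S i)) :
    (Measure.pi ν).real (allOpen T ∩ noneOpen s S) =
      (Measure.pi ν).real (allOpen T) * (Measure.pi ν).real (noneOpen s S) := by
  have hind : iIndepFun (fun e (ω : E → Bool) => ω e) (Measure.pi ν) :=
    iIndepFun_pi (X := fun _ b => b) fun e => aemeasurable_id
  have h := hind.indepFun_finset T Tᶜ disjoint_compl_right fun e => measurable_pi_apply e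
  have h2 := h.measure_inter_preimage_eq_mul
    (s := {x : T → Bool | ∀ e, x e = true})
    (t := {x : (Tᶜ : Finset E) → Bool | ∀ i ∈ s, ¬ ∀ e, e.1 ∈ S i → x e = true})
    (Set.toFinite _).measurableSet (Set.toFinite _).measurableSet
  have e1 : (fun (a : E → Bool) (i : T) => a i) ⁻¹' {x : T → Bool | ∀ e, x e = true}
      = allOpen T := by
    ext ω; simp [allOpen]
  have e2 : (fun (a : E → Bool) (i : (Tᶜ : Finset E)) => a i) ⁻¹'
      {x : (Tᶜ : Finset E) → Bool | ∀ i ∈ s, ¬ ∀ e, e.1 ∈ S i → x e = true}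
      = noneOpen s S := by
    ext ω
    simp only [noneOpen, allOpen, Set.mem_preimage, Set.mem_ofPred_eq]
    refine forall₂_congr fun i hi => not_congr ⟨fun h e he => ?_, fun h e he => h e he⟩
    refine h ⟨e, ?_⟩ he
    rw [Finset.mem_compl]
    exact fun h' => (Finset.disjoint_left.1 (hS i hi)) h' he
  rw [e1, e2] at h2
  simp only [measureReal_def, h2, ENNReal.toReal_mul]

variable {ι : Type*} [DecidableEq ι]

lemma noneOpen_insert (a : ι) (s : Finset ι) (S : ι → Finset E) :
    noneOpen (insert a s) S = (allOpen (S a))ᶜ ∩ noneOpen s S := by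
  ext ω
  simp [noneOpen]

/-- Lower bound for the probability that no event of a family of increasing events occurs. -/
lemma prod_le_noneOpen (s : Finset ι) (S : ι → Finset E) :
    ∏ i ∈ s, (1 - (Measure.pi ν).real (allOpen (S i))) ≤ (Measure.pi ν).real (noneOpen s S) := by
  induction s using Finset.induction_on with
  | empty => simp [noneOpen]
  | insert a s ha ih =>
    rw [Finset.prod_insert ha, noneOpen_insert]
    refine le_trans ?_ (harris_lower ν (isUpperSet_allOpen _).compl (isLowerSet_noneOpen s S))
    rw [probReal_compl_eq_one_sub (measurableSet_config _)]
    exact mul_le_mul_of_nonneg_left ih (sub_nonneg.2 measureReal_le_one)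

/-- **Janson's inequality** (with a non-optimal constant). -/
lemma janson (s : Finset ι) (S : ι → Finset E) :
    (Measure.pi ν).real (noneOpen s S) ≤
      Real.exp (-∑ i ∈ s, (Measure.pi ν).real (allOpen (S i)) +
        ∑ i ∈ s, ∑ j ∈ s with j ≠ i ∧ ¬ Disjoint (S i) (S j),
          (Measure.pi ν).real (allOpen (S i ∪ S j))) := by
  set P := (Measure.pi ν).real with hP
  induction s using Finset.induction_on with
  | empty => simp [noneOpen, hP]
  | insert a s ha ih =>
    set D := {j ∈ s | ¬ Disjoint (S a) (S j)} with hD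
    set C := noneOpen ({j ∈ s | Disjoint (S a) (S j)}) S with hC
    set δ := ∑ j ∈ D, P (allOpen (S a ∪ S j)) with hδ
    have hsubC : noneOpen s S ⊆ C := fun ω h i hi => h i (Finset.mem_filter.1 hi).1
    have hPC : P (allOpen (S a) ∩ C) = P (allOpen (S a)) * P C :=
      pi_real_allOpen_inter_noneOpen ν _ _ S fun i hi => (Finset.mem_filter.1 hi).2
    -- `C` retains only the events independent of that of `S a`. Passing from `C` back to `noneOpen
    -- s S` loses only configurations where some overlapping `S j` is open as well.
    have hcover : allOpen (S a) ∩ C ⊆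
        (allOpen (S a) ∩ noneOpen s S) ∪ ⋃ j ∈ D, (allOpen (S a ∪ S j) ∩ C) := by
      rintro ω ⟨h1, h2⟩
      by_cases h : ω ∈ noneOpen s S
      · exact Or.inl ⟨h1, h⟩
      · right
        simp only [noneOpen, Set.mem_ofPred_eq, not_forall, not_not] at h
        obtain ⟨j, hj, hjo⟩ := h
        have : j ∈ D := by
          rw [hD, Finset.mem_filter]
          refine ⟨hj, fun hd => h2 j (Finset.mem_filter.2 ⟨hj, hd⟩) hjo⟩
        simp only [Set.mem_iUnion]
        exact ⟨j, this, by rw [allOpen_union]; exact ⟨h1, hjo⟩, h2⟩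
    have hle : P (allOpen (S a)) * P C ≤ P (allOpen (S a) ∩ noneOpen s S) + δ * P C := by
      rw [← hPC]
      refine (measureReal_mono hcover).trans ((measureReal_union_le _ _).trans ?_)
      gcongr
      refine (measureReal_biUnion_finset_le _ _).trans ?_
      rw [hδ, Finset.sum_mul]
      exact Finset.sum_le_sum fun j _ =>
        harris_upper_lower ν (isUpperSet_allOpen _) (isLowerSet_noneOpen _ S)
    have hsplit : P (noneOpen (insert a s) S) =
        P (noneOpen s S) - P (allOpen (S a) ∩ noneOpen s S) := by
      rw [noneOpen_insert, Set.inter_comm, Set.inter_comm (allOpen (S a)), ← Set.sdiff_eq]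
      have := measureReal_inter_add_sdiff (μ := Measure.pi ν) (s := noneOpen s S)
        (measurableSet_config (allOpen (S a)))
      rw [← hP] at this
      linarith
    have hCx : P (noneOpen s S) ≤ P C := measureReal_mono hsubC
    have hx0 : 0 ≤ P (noneOpen s S) := measureReal_nonneg
    have hI0 : 0 ≤ P (allOpen (S a) ∩ noneOpen s S) := measureReal_nonneg
    have hstep : P (noneOpen (insert a s) S) ≤
        P (noneOpen s S) * Real.exp (-P (allOpen (S a)) + δ) := by
      have h1 : P (noneOpen (insert a s) S) ≤
          P (noneOpen s S) * (-P (allOpen (S a)) + δ + 1) := by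
        rw [hsplit]
        -- The estimate `P(A ∩ none) ≥ (P A - δ) P C` may be weakened from `P C` to the smaller
        -- probability of `noneOpen s S` only if `P A - δ ≥ 0`; otherwise the claimed factor is at
        -- least `1`.
        rcases le_total (P (allOpen (S a))) δ with h | h
        · nlinarith
        · nlinarith [mul_le_mul_of_nonneg_left hCx (sub_nonneg.2 h)]
      exact h1.trans (mul_le_mul_of_nonneg_left (Real.add_one_le_exp _) hx0)
    refine hstep.trans ((mul_le_mul_of_nonneg_right ih (Real.exp_pos _).le).trans ?_)
    rw [← Real.exp_add, Real.exp_le_exp, Finset.sum_insert ha, Finset.sum_insert ha]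
    have hA : δ ≤ ∑ j ∈ insert a s with j ≠ a ∧ ¬ Disjoint (S a) (S j),
        P (allOpen (S a ∪ S j)) := by
      refine Finset.sum_le_sum_of_subset_of_nonneg (fun j hj => ?_) fun _ _ _ => measureReal_nonneg
      rw [hD, Finset.mem_filter] at hj
      simp only [Finset.mem_filter, Finset.mem_insert]
      exact ⟨Or.inr hj.1, fun h => ha (h ▸ hj.1), hj.2⟩
    -- The induction pays for each unordered pair once, while the double sum counts it twice; the
    -- spare terms are dropped here, which costs the optimal constant.
    have hB : ∑ i ∈ s, ∑ j ∈ s with j ≠ i ∧ ¬ Disjoint (S i) (S j), P (allOpen (S i ∪ S j)) ≤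
        ∑ i ∈ s, ∑ j ∈ insert a s with j ≠ i ∧ ¬ Disjoint (S i) (S j),
          P (allOpen (S i ∪ S j)) := by
      refine Finset.sum_le_sum fun i _ => ?_
      exact Finset.sum_le_sum_of_subset_of_nonneg
        (Finset.filter_subset_filter _ (Finset.subset_insert _ _)) fun _ _ _ => measureReal_nonneg
    linarith

/-- **Chebyshev's inequality** for the probability that no event of a family occurs. -/
lemma noneOpen_mul_sq_le (s : Finset ι) (S : ι → Finset E) :
    (Measure.pi ν).real (noneOpen s S) *
      (∑ i ∈ s, (Measure.pi ν).real (allOpen (S i))) ^ 2 ≤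
        ∑ i ∈ s, ∑ j ∈ s with ¬ Disjoint (S i) (S j),
          (Measure.pi ν).real (allOpen (S i ∪ S j)) := by
  classical
  set P := (Measure.pi ν).real with hP
  set m := ∑ i ∈ s, P (allOpen (S i)) with hm
  set X : ι → (E → Bool) → ℝ := fun i => (allOpen (S i)).indicator (fun _ => (1 : ℝ)) with hX
  have hsum : ∀ U : Set (E → Bool), P U = ∑ ω, P {ω} * U.indicator (fun _ => (1 : ℝ)) ω :=
    pi_real_eq_sum ν
  have h1 : ∑ ω, P {ω} = 1 := by
    have := hsum Set.univ
    rw [show P Set.univ = 1 from probReal_univ] at this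
    simpa using this.symm
  have hE1 : ∑ ω, P {ω} * ∑ i ∈ s, X i ω = m := by
    simp only [Finset.mul_sum]
    rw [Finset.sum_comm, hm]
    exact Finset.sum_congr rfl fun i _ => (hsum _).symm
  have hE2 : ∑ ω, P {ω} * (∑ i ∈ s, X i ω) ^ 2 =
      ∑ i ∈ s, ∑ j ∈ s, P (allOpen (S i ∪ S j)) := by
    simp only [sq, Finset.sum_mul_sum]
    simp only [Finset.mul_sum]
    rw [Finset.sum_comm]
    refine Finset.sum_congr rfl fun i _ => ?_
    rw [Finset.sum_comm]
    refine Finset.sum_congr rfl fun j _ => ?_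
    rw [hsum, allOpen_union]
    refine Finset.sum_congr rfl fun ω _ => ?_
    by_cases h1 : ω ∈ allOpen (S i) <;> by_cases h2 : ω ∈ allOpen (S j) <;> simp [hX, h1, h2]
  -- Pairs with disjoint supports are independent, so together they contribute at most `m ^ 2`,
  -- which cancels in the variance.
  have hE2le : ∑ i ∈ s, ∑ j ∈ s, P (allOpen (S i ∪ S j)) ≤
      m ^ 2 + ∑ i ∈ s, ∑ j ∈ s with ¬ Disjoint (S i) (S j), P (allOpen (S i ∪ S j)) := by
    rw [sq, hm, Finset.sum_mul_sum, ← Finset.sum_add_distrib]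
    refine Finset.sum_le_sum fun i _ => ?_
    rw [← Finset.sum_filter_add_sum_filter_not s (fun j => Disjoint (S i) (S j))]
    refine add_le_add ?_ le_rfl
    refine le_trans (le_of_eq (Finset.sum_congr rfl fun j hj => ?_))
      (Finset.sum_le_sum_of_subset_of_nonneg (Finset.filter_subset _ _)
        fun _ _ _ => mul_nonneg measureReal_nonneg measureReal_nonneg)
    rw [hP, pi_real_allOpen, pi_real_allOpen, pi_real_allOpen,
      Finset.prod_union (Finset.mem_filter.1 hj).2]
  have hvar : P (noneOpen s S) * m ^ 2 ≤ ∑ ω, P {ω} * (∑ i ∈ s, X i ω - m) ^ 2 := by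
    rw [hsum, Finset.sum_mul]
    refine Finset.sum_le_sum fun ω _ => ?_
    rw [mul_assoc]
    refine mul_le_mul_of_nonneg_left ?_ measureReal_nonneg
    by_cases h : ω ∈ noneOpen s S
    · have : ∑ i ∈ s, X i ω = 0 := Finset.sum_eq_zero fun i hi => by
        simp only [hX]
        rw [Set.indicator_of_notMem (h i hi)]
      rw [this]; simp [h]
    · simp [h, sq_nonneg]
  have hexp : ∑ ω, P {ω} * (∑ i ∈ s, X i ω - m) ^ 2 =
      ∑ i ∈ s, ∑ j ∈ s, P (allOpen (S i ∪ S j)) - m ^ 2 := by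
    have : ∀ ω, P {ω} * (∑ i ∈ s, X i ω - m) ^ 2 = P {ω} * (∑ i ∈ s, X i ω) ^ 2
        - 2 * m * (P {ω} * ∑ i ∈ s, X i ω) + m ^ 2 * P {ω} := fun ω => by ring
    simp only [this]
    rw [Finset.sum_add_distrib, Finset.sum_sub_distrib, ← Finset.mul_sum, ← Finset.mul_sum,
      hE1, hE2, h1]
    ring
  linarith

end ProductMeasures

/-! ### Riemann integrable functions are bounded and almost everywhere continuous -/

section RiemannIntegrability

open BoxIntegral

variable {ι : Type*} [Fintype ι] {I : Box ι} {F : (ι → ℝ) → ℝ}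

/-- The Cauchy criterion for Riemann integrability: there is a partition for which the
Riemann sums depend little on the choice of the tags. -/
lemma exists_partition_tags_close
    (hF : BoxIntegral.Integrable I IntegrationParams.Riemann F BoxAdditiveMap.volume)
    {ε : ℝ} (hε : 0 < ε) :
    ∃ π : Prepartition I, π.IsPartition ∧ ∀ t t' : Box ι → ι → ℝ,
      (∀ J ∈ π, t J ∈ Box.Icc J) → (∀ J ∈ π, t' J ∈ Box.Icc J) →
      |∑ J ∈ π.boxes, volume.real (J : Set (ι → ℝ)) * (F (t J) - F (t' J))| ≤ ε := by
  classical
  set c := I.distortion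
  set R := hF.convergenceR (ε / 2) c with hR
  have hRc : ∀ x, R x = R 0 := hF.convergenceR_cond (ε / 2) c rfl
  have hR0 : 0 < (R 0 : ℝ) := (R 0).2
  -- Half the admissible mesh: by the triangle inequality, every choice of tags in the closed boxes
  -- then remains subordinate to the full radius, which is constant for the Riemann integral.
  obtain ⟨π, hπ, hπp⟩ := IntegrationParams.Riemann.exists_memBaseSet_isPartition I (le_refl c)
    (fun _ => ⟨(R 0 : ℝ) / 2, half_pos hR0⟩)
  refine ⟨π.toPrepartition, hπp, ?_⟩
  have key : ∀ t : Box ι → ι → ℝ, (∀ J ∈ π.toPrepartition, t J ∈ Box.Icc J) →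
      ∃ τ : TaggedPrepartition I, τ.toPrepartition = π.toPrepartition ∧
        IntegrationParams.Riemann.MemBaseSet I c R τ ∧
        integralSum F BoxAdditiveMap.volume τ =
          ∑ J ∈ π.boxes, volume.real (J : Set (ι → ℝ)) * F (t J) := by
    intro t ht
    refine ⟨⟨π.toPrepartition, fun J => if J ∈ π.toPrepartition then t J else π.tag J, ?_⟩,
      rfl, ⟨?_, ?_, ?_, ?_⟩, ?_⟩
    · intro J
      split_ifs with h
      · exact Box.le_iff_Icc.1 (π.le_of_mem h) (ht J h)
      · exact π.tag_mem_Icc J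
    · intro J hJ x hx
      have hJ' : J ∈ π.toPrepartition := hJ
      simp only [hJ', if_true]
      have h1 := hπ.isSubordinate J hJ hx
      have h2 := hπ.isSubordinate J hJ (ht J hJ)
      rw [hRc]
      rw [Metric.mem_closedBall] at h1 h2 ⊢
      have h3 := dist_triangle_right x (t J) (π.tag J)
      simp only at h1 h2
      linarith
    · intro _ J hJ
      have hJ' : J ∈ π.toPrepartition := hJ
      simp only [hJ', if_true]
      exact ht J hJ
    · intro h; exact absurd h (by decide)
    · intro h; exact absurd h (by decide)
    · unfold integralSum
      refine Finset.sum_congr rfl fun J hJ => ?_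
      have hJ' : J ∈ π.toPrepartition := hJ
      simp only [hJ', if_true]
      rw [BoxAdditiveMap.volume_apply, smul_eq_mul, measureReal_def, Box.volume_apply']
  intro t t' ht ht'
  obtain ⟨τ, h1, h2, h3⟩ := key t ht
  obtain ⟨τ', h1', h2', h3'⟩ := key t' ht'
  have := hF.dist_integralSum_le_of_memBaseSet (half_pos hε) (half_pos hε) h2 h2'
    (by rw [← TaggedPrepartition.iUnion_toPrepartition, ← TaggedPrepartition.iUnion_toPrepartition,
      h1, h1'])
  rw [h3, h3', Real.dist_eq, ← Finset.sum_sub_distrib] at this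
  simp only [← mul_sub] at this
  linarith

/-- A Riemann integrable function on a box is bounded. -/
lemma bounded_of_riemannIntegrable
    (hF : BoxIntegral.Integrable I IntegrationParams.Riemann F BoxAdditiveMap.volume) :
    ∃ M : ℝ, ∀ x ∈ I, |F x| ≤ M := by
  classical
  obtain ⟨π, hπ, h⟩ := exists_partition_tags_close hF one_pos
  have hpos : ∀ J : Box ι, 0 < volume.real (J : Set (ι → ℝ)) := by
    intro J
    rw [measureReal_def, Box.volume_apply']
    exact Finset.prod_pos fun i _ => sub_pos.2 (J.lower_lt_upper i)
  -- Moving the tag in a single box `J` changes the Riemann sum by at most `1`, so `F` stays within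
  -- `1 / volume J` of its value at the upper corner. Summing over all boxes gives a bound valid in
  -- each.
  refine ⟨∑ J ∈ π.boxes, (|F J.upper| + 1 / volume.real (J : Set (ι → ℝ))), fun x hx => ?_⟩
  obtain ⟨J, hJ, hxJ⟩ := hπ x hx
  have h1 := h (fun K => if K = J then x else K.upper) (fun K => K.upper)
    (fun K _ => by
      split_ifs with hK
      · rw [hK]; exact Box.coe_subset_Icc hxJ
      · exact K.upper_mem_Icc)
    (fun K _ => K.upper_mem_Icc)
  rw [Finset.sum_eq_single_of_mem J hJ (fun K _ hK => by simp [hK])] at h1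
  simp only [if_true] at h1
  rw [abs_mul, abs_of_pos (hpos J)] at h1
  have h2 : |F x - F J.upper| ≤ 1 / volume.real (J : Set (ι → ℝ)) := by
    rw [le_div_iff₀ (hpos J)]; linarith
  have h3 : |F x| ≤ |F J.upper| + 1 / volume.real (J : Set (ι → ℝ)) := by
    have := abs_sub_abs_le_abs_sub (F x) (F J.upper)
    linarith
  refine h3.trans (Finset.single_le_sum (f := fun J : Box ι => |F J.upper| +
    1 / volume.real (J : Set (ι → ℝ))) (fun K _ => ?_) hJ)
  have := (hpos K).le
  positivity

/-- The points near which `F` oscillates by at least `δ`. -/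
def oscSet (F : (ι → ℝ) → ℝ) (δ : ℝ) : Set (ι → ℝ) :=
  {x | ∀ U ∈ 𝓝 x, ∃ y ∈ U, ∃ z ∈ U, δ ≤ F y - F z}

lemma continuousAt_of_notMem_oscSet {x : ι → ℝ}
    (hx : ∀ q : ℕ, x ∉ oscSet F (1 / ((q : ℝ) + 1))) : ContinuousAt F x := by
  rw [ContinuousAt, Metric.tendsto_nhds]
  intro ε hε
  obtain ⟨q, hq⟩ := exists_nat_one_div_lt hε
  have := hx q
  simp only [oscSet, Set.mem_ofPred_eq, not_forall, not_exists, not_and, not_le] at this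
  obtain ⟨U, hU, h⟩ := this
  filter_upwards [hU] with y hy
  rw [Real.dist_eq, abs_lt]
  have h1 := h y hy x (mem_of_mem_nhds hU)
  have h2 := h x (mem_of_mem_nhds hU) y hy
  constructor <;> linarith

/-- Choose the tags so as to realise an oscillation of at least `δ` in every closed box that allows
it: the Cauchy criterion bounds the total volume of these boxes by `ε`. They cover the set, except
for points on the null boundaries of boxes. -/
lemma volume_oscSet_inter
    (hF : BoxIntegral.Integrable I IntegrationParams.Riemann F BoxAdditiveMap.volume)
    {δ : ℝ} (hδ : 0 < δ) : volume (oscSet F δ ∩ I) = 0 := by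
  classical
  refine le_antisymm (ENNReal.le_of_forall_pos_le_add fun ε hε _ => ?_) (zero_le)
  have hε' : (0 : ℝ) < δ * ε := mul_pos hδ (by exact_mod_cast hε)
  obtain ⟨π, hπ, h⟩ := exists_partition_tags_close hF hε'
  set bad : Box ι → Prop := fun J => ∃ y ∈ Box.Icc J, ∃ z ∈ Box.Icc J, δ ≤ F y - F z with hbad
  have hch : ∀ J : Box ι, ∃ p : (ι → ℝ) × (ι → ℝ), p.1 ∈ Box.Icc J ∧ p.2 ∈ Box.Icc J ∧
      0 ≤ F p.1 - F p.2 ∧ (bad J → δ ≤ F p.1 - F p.2) := by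
    intro J
    by_cases hJ : bad J
    · obtain ⟨y, hy, z, hz, hyz⟩ := hJ
      exact ⟨(y, z), hy, hz, by simp only; linarith, fun _ => hyz⟩
    · exact ⟨(J.upper, J.upper), J.upper_mem_Icc, J.upper_mem_Icc, by simp, fun h => absurd h hJ⟩
  choose p hp1 hp2 hp3 hp4 using hch
  have h1 := (le_abs_self _).trans (h (fun J => (p J).1) (fun J => (p J).2)
    (fun J _ => hp1 J) (fun J _ => hp2 J))
  have h2 : δ * ∑ J ∈ π.boxes with bad J, volume.real (J : Set (ι → ℝ)) ≤ δ * ε := by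
    refine le_trans ?_ h1
    rw [Finset.mul_sum, Finset.sum_filter]
    refine Finset.sum_le_sum fun J _ => ?_
    split_ifs with hJ
    · rw [mul_comm]
      exact mul_le_mul_of_nonneg_left (hp4 J hJ) measureReal_nonneg
    · exact mul_nonneg measureReal_nonneg (hp3 J)
  have h3 := le_of_mul_le_mul_left h2 hδ
  have hcover : oscSet F δ ∩ I ⊆
      (⋃ J ∈ π.boxes.filter bad, (J : Set (ι → ℝ))) ∪
      ⋃ J ∈ π.boxes, ((J : Set (ι → ℝ)) \ Box.Ioo J) := by
    rintro x ⟨hx, hxI⟩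
    obtain ⟨J, hJ, hxJ⟩ := hπ x hxI
    by_cases hxo : x ∈ Box.Ioo J
    · left
      have hopen : Box.Ioo J ∈ 𝓝 x := by
        refine IsOpen.mem_nhds ?_ hxo
        exact isOpen_set_pi Set.finite_univ fun i _ => isOpen_Ioo
      obtain ⟨y, hy, z, hz, hyz⟩ := hx _ hopen
      simp only [Set.mem_iUnion]
      exact ⟨J, Finset.mem_filter.2 ⟨hJ, y, Box.Ioo_subset_Icc J hy, z, Box.Ioo_subset_Icc J hz,
        hyz⟩, hxJ⟩
    · right
      simp only [Set.mem_iUnion]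
      exact ⟨J, hJ, hxJ, hxo⟩
  have hnull : volume (⋃ J ∈ π.boxes, ((J : Set (ι → ℝ)) \ Box.Ioo J)) = 0 := by
    refine (measure_biUnion_null_iff π.boxes.countable_toSet).2 fun J _ => ?_
    exact ae_le_set.1 ((Box.Ioo_ae_eq_Icc J).trans (Box.coe_ae_eq_Icc J).symm).symm.le
  have hfin : ∀ J : Box ι, volume (J : Set (ι → ℝ)) ≠ ⊤ := fun J => J.measure_coe_lt_top volume |>.ne
  calc volume (oscSet F δ ∩ I) ≤ _ := measure_mono hcover
    _ ≤ _ := measure_union_le _ _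
    _ = volume (⋃ J ∈ π.boxes.filter bad, (J : Set (ι → ℝ))) := by rw [hnull, add_zero]
    _ ≤ ∑ J ∈ π.boxes.filter bad, volume (J : Set (ι → ℝ)) := measure_biUnion_finset_le _ _
    _ = ENNReal.ofReal (∑ J ∈ π.boxes.filter bad, volume.real (J : Set (ι → ℝ))) := by
      rw [ENNReal.ofReal_sum_of_nonneg fun _ _ => measureReal_nonneg]
      exact Finset.sum_congr rfl fun J _ => (ofReal_measureReal (hfin J)).symm
    _ ≤ ENNReal.ofReal ε := ENNReal.ofReal_le_ofReal h3
    _ = 0 + ε := by simp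

/-- A Riemann integrable function on a box is continuous at almost every point of the box. -/
lemma ae_continuousAt_of_riemannIntegrable
    (hF : BoxIntegral.Integrable I IntegrationParams.Riemann F BoxAdditiveMap.volume) :
    ∀ᵐ x ∂(volume : Measure (ι → ℝ)), x ∈ I → ContinuousAt F x := by
  have h : ∀ q : ℕ, ∀ᵐ x ∂(volume : Measure (ι → ℝ)), x ∉ oscSet F (1 / ((q : ℝ) + 1)) ∩ I :=
    fun q => measure_eq_zero_iff_ae_notMem.1 (volume_oscSet_inter hF (by positivity))
  filter_upwards [ae_all_iff.2 h] with x hx hxI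
  exact continuousAt_of_notMem_oscSet fun q hq => hx q ⟨hq, hxI⟩

end RiemannIntegrability

/-! ### Path integrals as limits of sums over the grid -/

section RiemannSums

/-- The half-open unit cube. -/
def unitCube (d : ℕ) : Set (Fin d → ℝ) := Set.univ.pi fun _ => Set.Ioc 0 1

lemma measurableSet_unitCube (d : ℕ) : MeasurableSet (unitCube d) :=
  MeasurableSet.univ_pi fun _ => measurableSet_Ioc

lemma volume_unitCube_lt_top (d : ℕ) : volume (unitCube d) < ⊤ := by
  rw [unitCube, Real.volume_pi_Ioc]
  exact ENNReal.prod_lt_top fun _ _ => ENNReal.ofReal_lt_top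

/-- The index of the cell of the grid of mesh `1 / n` which contains `u`. -/
def gridIndex (n : ℕ) {d : ℕ} (u : Fin d → ℝ) : Fin d → ℕ := fun j => ⌈(n : ℝ) * u j⌉₊

lemma measurable_gridIndex (n d : ℕ) : Measurable (gridIndex n : (Fin d → ℝ) → Fin d → ℕ) :=
  measurable_pi_iff.2 fun j => Nat.measurable_ceil.comp ((measurable_pi_apply j).const_mul _)

lemma ceil_mem_Icc {n : ℕ} (hn : 0 < n) {x : ℝ} (hx : x ∈ Set.Ioc (0 : ℝ) 1) :
    ⌈(n : ℝ) * x⌉₊ ∈ Finset.Icc 1 n := by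
  have hn' : (0 : ℝ) < n := by exact_mod_cast hn
  rw [Finset.mem_Icc]
  refine ⟨Nat.one_le_ceil_iff.2 (mul_pos hn' hx.1), Nat.ceil_le.2 ?_⟩
  nlinarith [hx.2]

lemma gridIndex_preimage {n d : ℕ} (hn : 0 < n) {i : Fin d → ℕ} (hi : ∀ j, i j ∈ Finset.Icc 1 n) :
    gridIndex n ⁻¹' {i} =
      Set.univ.pi fun j => Set.Ioc (((i j : ℝ) - 1) / n) ((i j : ℝ) / n) := by
  have hn' : (0 : ℝ) < n := by exact_mod_cast hn
  ext u
  simp only [Set.mem_preimage, Set.mem_singleton_iff, Set.mem_pi, Set.mem_univ, true_imp_iff,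
    Set.mem_Ioc, funext_iff, gridIndex]
  refine forall_congr' fun j => ?_
  have h1 := (Finset.mem_Icc.1 (hi j)).1
  rw [Nat.ceil_eq_iff (by omega), Nat.cast_sub h1, Nat.cast_one, div_lt_iff₀ hn', le_div_iff₀ hn',
    mul_comm (u j)]

lemma gridIndex_preimage_subset {n d : ℕ} (hn : 0 < n) {i : Fin d → ℕ}
    (hi : ∀ j, i j ∈ Finset.Icc 1 n) : gridIndex n ⁻¹' {i} ⊆ unitCube d := by
  have hn' : (0 : ℝ) < n := by exact_mod_cast hn
  rw [gridIndex_preimage hn hi]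
  refine Set.pi_mono fun j _ => Set.Ioc_subset_Ioc ?_ ?_
  · have h1 : (1 : ℝ) ≤ i j := by exact_mod_cast (Finset.mem_Icc.1 (hi j)).1
    exact div_nonneg (by linarith) hn'.le
  · have h1 : (i j : ℝ) ≤ n := by exact_mod_cast (Finset.mem_Icc.1 (hi j)).2
    exact div_le_one_of_le₀ h1 hn'.le

/-- The integral of a function which is constant on the cells of the grid. -/
lemma integral_gridIndex {n d : ℕ} (hn : 0 < n) (g : (Fin d → ℕ) → ℝ) :
    ∫ u in unitCube d, g (gridIndex n u) =
      (∑ i ∈ Fintype.piFinset (fun _ => Finset.Icc 1 n), g i) / (n : ℝ) ^ d := by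
  have hn' : (0 : ℝ) < n := by exact_mod_cast hn
  have hmeas : ∀ i : Fin d → ℕ, MeasurableSet (gridIndex n ⁻¹' {i}) := fun i =>
    measurable_gridIndex n d (measurableSet_singleton i)
  have hunion : unitCube d =
      ⋃ i ∈ Fintype.piFinset (fun _ : Fin d => Finset.Icc 1 n), gridIndex n ⁻¹' {i} := by
    ext u
    simp only [Set.mem_iUnion, Set.mem_preimage, Set.mem_singleton_iff, exists_prop,
      exists_eq_right', Fintype.mem_piFinset]
    constructor
    · exact fun hu j => ceil_mem_Icc hn (hu j trivial)
    · exact fun h => gridIndex_preimage_subset hn h rfl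
  have hvol : ∀ i ∈ Fintype.piFinset (fun _ : Fin d => Finset.Icc 1 n),
      volume.real (gridIndex n ⁻¹' {i}) = 1 / (n : ℝ) ^ d := by
    intro i hi
    rw [Fintype.mem_piFinset] at hi
    rw [gridIndex_preimage hn hi, measureReal_def, Real.volume_pi_Ioc_toReal]
    · simp [← sub_div]
    · intro j
      exact div_le_div_of_nonneg_right (by linarith) hn'.le
  rw [hunion, integral_biUnion_finset _ (fun i _ => hmeas i)]
  · rw [Finset.sum_div]
    refine Finset.sum_congr rfl fun i hi => ?_
    rw [setIntegral_congr_fun (g := fun _ => g i) (hmeas i)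
      (fun u (hu : gridIndex n u = i) => by simp only [hu]), setIntegral_const, hvol i hi,
      smul_eq_mul]
    ring
  · intro i _ j _ hij
    exact Disjoint.preimage _ (Set.disjoint_singleton.2 hij)
  · intro i hi
    rw [Fintype.mem_piFinset] at hi
    refine (integrableOn_congr_fun (g := fun _ => g i)
      (fun u (hu : gridIndex n u = i) => by simp only [hu]) (hmeas i)).2 ?_
    exact integrableOn_const
      ((measure_mono (gridIndex_preimage_subset hn hi)).trans_lt (volume_unitCube_lt_top d)).ne

/-- The sequence `(1, i₁, …, i_d, n)`. -/
def withEnds (n : ℕ) {d : ℕ} (i : Fin d → ℕ) : Fin (d + 2) → ℕ :=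
  Fin.cons 1 (Fin.snoc i n : Fin (d + 1) → ℕ)

/-- The interior vertices of the increasing paths with `d + 1` edges from `1` to `n`. -/
def increasingPaths (n d : ℕ) : Finset (Fin d → ℕ) :=
  (Fintype.piFinset fun _ => Finset.Icc 1 n).filter fun i => StrictMono (withEnds n i)

/-- The product of the values of `f` along a path in the rescaled grid. -/
def gridProduct (f : ℝ → ℝ → ℝ) (n : ℕ) {d : ℕ} (i : Fin d → ℕ) : ℝ :=
  ∏ j : Fin (d + 1), f ((withEnds n i j.castSucc : ℝ) / n) ((withEnds n i j.succ : ℝ) / n)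

section Index

variable {d : ℕ} (n : ℕ) (i : Fin d → ℕ) (u : Fin d → ℝ)

@[simp] lemma withEnds_zero : withEnds n i 0 = 1 := rfl

@[simp] lemma withEnds_last : withEnds n i (Fin.last _) = n := by
  rw [withEnds, ← Fin.succ_last, Fin.cons_succ, Fin.snoc_last]

@[simp] lemma withEnds_succ_castSucc (a : Fin d) : withEnds n i a.castSucc.succ = i a := by
  rw [withEnds, Fin.cons_succ, Fin.snoc_castSucc]

@[simp] lemma addEnds_zero : addEnds u 0 = 0 := rfl

@[simp] lemma addEnds_last : addEnds u (Fin.last _) = 1 := by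
  rw [addEnds, ← Fin.succ_last, Fin.cons_succ, Fin.snoc_last]

@[simp] lemma addEnds_succ_castSucc (a : Fin d) : addEnds u a.castSucc.succ = u a := by
  rw [addEnds, Fin.cons_succ, Fin.snoc_castSucc]

lemma withEnds_gridIndex_succ (j : Fin (d + 1)) :
    withEnds n (gridIndex n u) j.succ = ⌈(n : ℝ) * addEnds u j.succ⌉₊ := by
  induction j using Fin.lastCases with
  | last => simp
  | cast a => simp [gridIndex]

end Index

lemma tendsto_ceil_div {x : ℝ} (hx : 0 ≤ x) :
    Tendsto (fun n : ℕ => (⌈(n : ℝ) * x⌉₊ : ℝ) / n) atTop (𝓝 x) := by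
  have h := (tendsto_nat_ceil_mul_div_atTop hx).comp tendsto_natCast_atTop_atTop
  refine h.congr fun n => ?_
  simp [mul_comm]

lemma tendsto_withEnds {d : ℕ} {u : Fin d → ℝ} (hu : ∀ j, 0 ≤ addEnds u j) (j : Fin (d + 2)) :
    Tendsto (fun n : ℕ => (withEnds n (gridIndex n u) j : ℝ) / n) atTop (𝓝 (addEnds u j)) := by
  induction j using Fin.cases with
  | zero => simpa using tendsto_one_div_atTop_nhds_zero_nat (𝕜 := ℝ)
  | succ j =>
    simp only [withEnds_gridIndex_succ]
    exact tendsto_ceil_div (hu _)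

lemma addEnds_mem_Icc {d : ℕ} {u : Fin d → ℝ} (hu : u ∈ orderedSimplex d) (j : Fin (d + 2)) :
    addEnds u j ∈ Set.Icc (0 : ℝ) 1 := by
  have hu' : StrictMono (addEnds u) := hu
  exact ⟨by simpa using hu'.monotone (Fin.zero_le j), by simpa using hu'.monotone (Fin.le_last j)⟩

lemma orderedSimplex_subset (d : ℕ) : orderedSimplex d ⊆ unitCube d := by
  intro u hu a _
  have hu' : StrictMono (addEnds u) := hu
  have h1 := hu' (Fin.succ_pos a.castSucc)
  have h2 := hu' (a := a.castSucc.succ) (b := Fin.last _) (Fin.lt_last_iff_ne_last.2 (by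
    rw [← Fin.succ_last, Ne, Fin.succ_inj]; exact (Fin.castSucc_lt_last a).ne))
  simp only [addEnds_zero, addEnds_last, addEnds_succ_castSucc] at h1 h2
  exact ⟨h1, h2.le⟩

lemma eventually_strictMono_withEnds {d : ℕ} {u : Fin d → ℝ} (hu : u ∈ orderedSimplex d) :
    ∀ᶠ n : ℕ in atTop, StrictMono (withEnds n (gridIndex n u)) := by
  have h : ∀ j : Fin (d + 1), ∀ᶠ n : ℕ in atTop,
      withEnds n (gridIndex n u) j.castSucc < withEnds n (gridIndex n u) j.succ := by
    intro j
    have hlt : addEnds u j.castSucc < addEnds u j.succ := hu Fin.castSucc_lt_succ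
    have h0 := fun j => (addEnds_mem_Icc hu j).1
    filter_upwards [(tendsto_withEnds h0 j.castSucc).eventually_lt (tendsto_withEnds h0 j.succ) hlt,
      eventually_gt_atTop 0] with n hn hn0
    have hn' : (0 : ℝ) < n := by exact_mod_cast hn0
    exact_mod_cast (div_lt_div_iff_of_pos_right hn').1 hn
  filter_upwards [eventually_all.2 h] with n hn
  exact Fin.strictMono_iff_lt_succ.2 hn

/-- Ceilings are monotone, so a strict inequality between them reflects to the points. The first
inequality is separate, because the path starts at `1` whereas `⌈n · 0⌉₊ = 0`; it comes from the
cube being open at `0`. -/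
lemma mem_orderedSimplex_of_strictMono {n d : ℕ} {u : Fin d → ℝ} (hu : u ∈ unitCube d)
    (h : StrictMono (withEnds n (gridIndex n u))) : u ∈ orderedSimplex d := by
  refine Fin.strictMono_iff_lt_succ.2 fun j => ?_
  induction j using Fin.cases with
  | zero =>
    rw [Fin.castSucc_zero, addEnds_zero]
    rcases Fin.eq_castSucc_or_eq_last (0 : Fin (d + 1)) with ⟨a, ha⟩ | ha
    · rw [ha, addEnds_succ_castSucc]; exact (hu a trivial).1
    · rw [ha, Fin.succ_last, addEnds_last]; exact one_pos
  | succ j =>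
    have h1 := h (Fin.castSucc_lt_succ (i := j.succ))
    rw [← Fin.succ_castSucc] at h1 ⊢
    rw [withEnds_gridIndex_succ, withEnds_gridIndex_succ] at h1
    by_contra hle
    exact absurd (Nat.ceil_mono (mul_le_mul_of_nonneg_left (not_lt.1 hle) (Nat.cast_nonneg n)))
      (not_le.2 h1)

/-- Two distinct coordinates form a surjective linear map onto the plane, under which null sets pull
back to null sets. -/
lemma ae_pair {d : ℕ} {s : Set (Fin 2 → ℝ)} (hs : ∀ᵐ x, x ∈ s) {a b : Fin d} (hab : a ≠ b) :
    ∀ᵐ u : Fin d → ℝ, ![u a, u b] ∈ s := by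
  obtain ⟨t, hts, htm, ht0⟩ := exists_measurable_superset_of_null (s := sᶜ) hs
  let L : (Fin d → ℝ) →ₗ[ℝ] (Fin 2 → ℝ) :=
    LinearMap.pi ![LinearMap.proj a, LinearMap.proj b]
  have hL : Function.Surjective L := by
    intro x
    refine ⟨Function.update (Function.update 0 a (x 0)) b (x 1), ?_⟩
    ext i
    fin_cases i
    · simp [L, Function.update_of_ne hab]
    · simp [L]
  have h := (ae_comp_linearMap_mem_iff L volume volume hL htm.compl).2
    (measure_eq_zero_iff_ae_notMem.1 ht0)
  filter_upwards [h] with u hu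
  by_contra hc
  refine hu (hts ?_)
  have : L u = ![u a, u b] := by
    ext i
    fin_cases i <;> simp [L]
  rwa [this]

lemma ae_eval {d : ℕ} {p : ℝ → Prop} (hp : ∀ᵐ x : ℝ, p x) (a : Fin d) :
    ∀ᵐ u : Fin d → ℝ, p (u a) :=
  (Measure.quasiMeasurePreserving_eval (fun _ : Fin d => (volume : Measure ℝ)) a).ae hp

variable {f : ℝ → ℝ → ℝ}

/-- The product converges factor by factor. There is at least one interior vertex, so the first and
last edges are distinct and no factor requires continuity at the corner `(0, 1)`. -/
lemma tendsto_gridProduct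
    (hc : ∀ᵐ x : Fin 2 → ℝ, x ∈ unitBox → ContinuousAt (fun x : Fin 2 → ℝ => f (x 0) (x 1)) x)
    (hleft : ∀ᵐ t : ℝ ∂(volume.restrict (Set.Icc (0 : ℝ) 1)),
      ContinuousWithinAt (fun p : ℝ × ℝ => f p.1 p.2)
        (Set.Icc (0 : ℝ) 1 ×ˢ Set.Icc (0 : ℝ) 1) (0, t))
    (hright : ∀ᵐ t : ℝ ∂(volume.restrict (Set.Icc (0 : ℝ) 1)),
      ContinuousWithinAt (fun s : ℝ => f s 1) (Set.Icc (0 : ℝ) 1) t) (e : ℕ) :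
    ∀ᵐ u : Fin (e + 1) → ℝ, u ∈ orderedSimplex (e + 1) →
      Tendsto (fun n : ℕ => gridProduct f n (gridIndex n u)) atTop
        (𝓝 (pathProduct f (e + 1) u)) := by
  rw [ae_restrict_iff' measurableSet_Icc] at hleft hright
  have hmid : ∀ᵐ u : Fin (e + 1) → ℝ, ∀ b : Fin e, ![u b.castSucc, u b.succ] ∈
      {x | x ∈ unitBox → ContinuousAt (fun x : Fin 2 → ℝ => f (x 0) (x 1)) x} :=
    ae_all_iff.2 fun b => ae_pair hc (Fin.castSucc_lt_succ).ne
  filter_upwards [ae_eval hleft 0, ae_eval hright (Fin.last e), hmid] with u hl hr hm hu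
  have h0 := fun j => (addEnds_mem_Icc hu j).1
  have hT := tendsto_withEnds h0
  have hcube := orderedSimplex_subset _ hu
  have hIcc : ∀ᶠ n : ℕ in atTop, ∀ j,
      (withEnds n (gridIndex n u) j : ℝ) / n ∈ Set.Icc (0 : ℝ) 1 := by
    filter_upwards [eventually_gt_atTop 0, eventually_strictMono_withEnds hu] with n hn hmono j
    have hn' : (0 : ℝ) < n := by exact_mod_cast hn
    refine ⟨by positivity, div_le_one_of_le₀ ?_ hn'.le⟩
    have := hmono.monotone (Fin.le_last j)
    rw [withEnds_last] at this
    exact_mod_cast this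
  refine tendsto_finsetProd _ fun j _ => ?_
  induction j using Fin.cases with
  | zero =>
    -- The first edge starts at `1 / n`, not at `0`, so both arguments vary and joint continuity at
    -- the side is needed.
    have h1 := hl ⟨(hcube 0 trivial).1.le, (hcube 0 trivial).2⟩
    have e1 : addEnds u (Fin.succ 0) = u 0 := addEnds_succ_castSucc u 0
    have h2 : Tendsto (fun n : ℕ => ((withEnds n (gridIndex n u) 0 : ℝ) / n,
        (withEnds n (gridIndex n u) (Fin.succ 0) : ℝ) / n)) atTop
        (𝓝[Set.Icc (0 : ℝ) 1 ×ˢ Set.Icc (0 : ℝ) 1] (0, u 0)) := by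
      refine tendsto_nhdsWithin_iff.2 ⟨?_, hIcc.mono fun n hn => ⟨hn _, hn _⟩⟩
      rw [← e1]
      exact (hT 0).prodMk_nhds (hT _)
    have h3 := h1.tendsto.comp h2
    simp only [Fin.castSucc_zero, addEnds_zero, e1]
    exact h3
  | succ a =>
    induction a using Fin.lastCases with
    | last =>
      -- The last edge ends exactly at `n / n = 1`, so continuity along the side suffices.
      have h1 := hr ⟨(hcube _ trivial).1.le, (hcube _ trivial).2⟩
      have e1 : addEnds u (Fin.last e).succ.castSucc = u (Fin.last e) := by
        rw [← Fin.succ_castSucc, addEnds_succ_castSucc]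
      have h2 : Tendsto (fun n : ℕ =>
          (withEnds n (gridIndex n u) (Fin.last e).succ.castSucc : ℝ) / n) atTop
          (𝓝[Set.Icc (0 : ℝ) 1] (u (Fin.last e))) := by
        refine tendsto_nhdsWithin_iff.2 ⟨?_, hIcc.mono fun n hn => hn _⟩
        rw [← e1]
        exact hT _
      have h3 := h1.tendsto.comp h2
      rw [e1, Fin.succ_last, Fin.succ_last, addEnds_last]
      refine h3.congr' ?_
      filter_upwards [eventually_gt_atTop 0] with n hn
      have hn' : (n : ℝ) ≠ 0 := by exact_mod_cast hn.ne'
      rw [Function.comp_apply, ← Fin.succ_last, ← Fin.succ_last, Fin.succ_last (n := e + 1),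
        withEnds_last, div_self hn']
    | cast b =>
      have e1 : addEnds u b.castSucc.succ.castSucc = u b.castSucc := by
        rw [← Fin.succ_castSucc, addEnds_succ_castSucc]
      have e2 : addEnds u b.castSucc.succ.succ = u b.succ := by
        rw [Fin.succ_castSucc, addEnds_succ_castSucc]
      have h1 := hm b (fun i => by
        fin_cases i
        · exact hcube _ trivial
        · exact hcube _ trivial)
      have h2 : Tendsto (fun n : ℕ =>
          ![(withEnds n (gridIndex n u) b.castSucc.succ.castSucc : ℝ) / n,
            (withEnds n (gridIndex n u) b.castSucc.succ.succ : ℝ) / n]) atTop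
          (𝓝 ![u b.castSucc, u b.succ]) := by
        rw [tendsto_pi_nhds]
        intro i
        fin_cases i
        · simpa [e1] using hT b.castSucc.succ.castSucc
        · simpa [e2] using hT b.castSucc.succ.succ
      have h3 := h1.tendsto.comp h2
      rw [e1, e2]
      exact h3

lemma abs_gridProduct_le {M : ℝ} (hM : ∀ x ∈ Set.Ioc (0 : ℝ) 1, ∀ y ∈ Set.Ioc (0 : ℝ) 1,
    |f x y| ≤ M) {n d : ℕ} (hn : 0 < n) {i : Fin d → ℕ} (hi : StrictMono (withEnds n i)) :
    |gridProduct f n i| ≤ M ^ (d + 1) := by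
  have hn' : (0 : ℝ) < n := by exact_mod_cast hn
  have hmem : ∀ j, (withEnds n i j : ℝ) / n ∈ Set.Ioc (0 : ℝ) 1 := by
    intro j
    have h1 := hi.monotone (Fin.zero_le j)
    have h2 := hi.monotone (Fin.le_last j)
    rw [withEnds_zero] at h1
    rw [withEnds_last] at h2
    have h1' : (1 : ℝ) ≤ withEnds n i j := by exact_mod_cast h1
    have h2' : (withEnds n i j : ℝ) ≤ n := by exact_mod_cast h2
    exact ⟨div_pos (by linarith) hn', div_le_one_of_le₀ h2' hn'.le⟩
  rw [gridProduct, Finset.abs_prod]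
  refine (Finset.prod_le_prod (fun _ _ => abs_nonneg _)
    (fun j _ => hM _ (hmem j.castSucc) _ (hmem j.succ))).trans_eq ?_
  simp

lemma measurableSet_orderedSimplex (d : ℕ) : MeasurableSet (orderedSimplex d) := by
  have : orderedSimplex d = ⋂ j : Fin (d + 1), {u | addEnds u j.castSucc < addEnds u j.succ} := by
    ext u
    simp only [orderedSimplex, Set.mem_ofPred_eq, Fin.strictMono_iff_lt_succ, Set.mem_iInter]
  have hm : ∀ j : Fin (d + 2), Measurable fun u : Fin d → ℝ => addEnds u j := by
    intro j
    induction j using Fin.cases with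
    | zero => exact measurable_const
    | succ j =>
      induction j using Fin.lastCases with
      | last => simp only [Fin.succ_last, addEnds_last]; exact measurable_const
      | cast a => simp only [addEnds_succ_castSucc]; exact measurable_pi_apply a
  rw [this]
  exact MeasurableSet.iInter fun j => measurableSet_lt (hm _) (hm _)

/-- The path integrals are limits of Riemann sums over increasing paths. -/
theorem tendsto_sum_gridProduct {M : ℝ}
    (hM : ∀ x ∈ Set.Ioc (0 : ℝ) 1, ∀ y ∈ Set.Ioc (0 : ℝ) 1, |f x y| ≤ M)
    (hc : ∀ᵐ x : Fin 2 → ℝ, x ∈ unitBox → ContinuousAt (fun x : Fin 2 → ℝ => f (x 0) (x 1)) x)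
    (hleft : ∀ᵐ t : ℝ ∂(volume.restrict (Set.Icc (0 : ℝ) 1)),
      ContinuousWithinAt (fun p : ℝ × ℝ => f p.1 p.2)
        (Set.Icc (0 : ℝ) 1 ×ˢ Set.Icc (0 : ℝ) 1) (0, t))
    (hright : ∀ᵐ t : ℝ ∂(volume.restrict (Set.Icc (0 : ℝ) 1)),
      ContinuousWithinAt (fun s : ℝ => f s 1) (Set.Icc (0 : ℝ) 1) t) (e : ℕ) :
    IntegrableOn (pathProduct f (e + 1)) (orderedSimplex (e + 1)) ∧
    Tendsto (fun n : ℕ => (∑ i ∈ increasingPaths n (e + 1), gridProduct f n i) / (n : ℝ) ^ (e + 1))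
      atTop (𝓝 (∫ u in orderedSimplex (e + 1), pathProduct f (e + 1) u)) := by
  classical
  set d := e + 1 with hd
  set G : ℕ → (Fin d → ℕ) → ℝ := fun n i =>
    if StrictMono (withEnds n i) then gridProduct f n i else 0 with hG
  set h : (Fin d → ℝ) → ℝ := (orderedSimplex d).indicator (pathProduct f d) with hh
  have hM0 : 0 ≤ M := (abs_nonneg _).trans (hM 1 (by simp) 1 (by simp))
  have hmeas : ∀ n, AEStronglyMeasurable (fun u => G n (gridIndex n u))
      (volume.restrict (unitCube d)) := fun n =>
    ((measurable_of_countable (G n)).comp (measurable_gridIndex n d)).aestronglyMeasurable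
  have hbound : ∀ n, 0 < n → ∀ u, ‖G n (gridIndex n u)‖ ≤ M ^ (d + 1) := by
    intro n hn u
    simp only [hG]
    split_ifs with hs
    · exact abs_gridProduct_le hM hn hs
    · simp [pow_nonneg hM0]
  have hlim : ∀ᵐ u ∂(volume.restrict (unitCube d)),
      Tendsto (fun n => G n (gridIndex n u)) atTop (𝓝 (h u)) := by
    rw [ae_restrict_iff' (measurableSet_unitCube d)]
    filter_upwards [tendsto_gridProduct hc hleft hright e] with u hu huc
    by_cases hs : u ∈ orderedSimplex d
    · rw [hh, Set.indicator_of_mem hs]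
      refine (hu hs).congr' ?_
      filter_upwards [eventually_strictMono_withEnds hs] with n hn
      rw [hG]; exact (if_pos hn).symm
    · rw [hh, Set.indicator_of_notMem hs]
      refine tendsto_const_nhds.congr fun n => ?_
      rw [hG]
      exact (if_neg fun hn => hs (mem_orderedSimplex_of_strictMono huc hn)).symm
  have : IsFiniteMeasure (volume.restrict (unitCube d)) :=
    ⟨by rw [Measure.restrict_apply_univ]; exact volume_unitCube_lt_top d⟩
  -- Even the measurability of the limit is obtained from the step functions: it is an almost
  -- everywhere limit of functions factoring through a countable type.
  have hint : Integrable h (volume.restrict (unitCube d)) := by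
    refine Integrable.of_bound (aestronglyMeasurable_of_tendsto_ae atTop hmeas hlim)
      (M ^ (d + 1)) ?_
    filter_upwards [hlim] with u hu
    refine le_of_tendsto hu.norm ?_
    filter_upwards [eventually_gt_atTop 0] with n hn
    exact hbound n hn u
  have hres : (volume.restrict (unitCube d)).restrict (orderedSimplex d) =
      volume.restrict (orderedSimplex d) := by
    rw [Measure.restrict_restrict (measurableSet_orderedSimplex d),
      Set.inter_eq_left.2 (orderedSimplex_subset d)]
  constructor
  · have := (integrable_indicator_iff (measurableSet_orderedSimplex d)).1 hint
    rwa [IntegrableOn, hres] at this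
  · have hD := tendsto_integral_filter_of_dominated_convergence (μ := volume.restrict (unitCube d))
      (l := atTop) (F := fun n u => G n (gridIndex n u)) (fun _ => M ^ (d + 1))
      (Eventually.of_forall hmeas)
      (by filter_upwards [eventually_gt_atTop 0] with n hn
          exact Eventually.of_forall (hbound n hn))
      (integrable_const _) hlim
    rw [hh, integral_indicator (measurableSet_orderedSimplex d), hres] at hD
    refine hD.congr' ?_
    filter_upwards [eventually_gt_atTop 0] with n hn
    rw [integral_gridIndex hn, increasingPaths, Finset.sum_filter]

end RiemannSums

/-! ### Counting pairs of paths with common edges -/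

section PathPairs

variable {n d : ℕ}

lemma mem_increasingPaths {i : Fin d → ℕ} :
    i ∈ increasingPaths n d ↔ StrictMono (withEnds n i) := by
  rw [increasingPaths, Finset.mem_filter, and_iff_right_iff_imp, Fintype.mem_piFinset]
  intro h a
  have h1 := h.monotone (Fin.zero_le a.castSucc.succ)
  have h2 := h.monotone (Fin.le_last a.castSucc.succ)
  rw [withEnds_zero, withEnds_succ_castSucc] at h1
  rw [withEnds_last, withEnds_succ_castSucc] at h2
  exact Finset.mem_Icc.2 ⟨h1, h2⟩

lemma card_increasingPaths_le (n d : ℕ) : (increasingPaths n d).card ≤ n ^ d := by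
  refine (Finset.card_filter_le _ _).trans_eq ?_
  simp

/-- The `j`-th edge of a path. -/
def pathPair (n : ℕ) {d : ℕ} (i : Fin d → ℕ) (j : Fin (d + 1)) : ℕ × ℕ :=
  (withEnds n i j.castSucc, withEnds n i j.succ)

/-- The set of the edges of a path. -/
def pathPairs (n : ℕ) {d : ℕ} (i : Fin d → ℕ) : Finset (ℕ × ℕ) := Finset.univ.image (pathPair n i)

lemma pathPair_injective {i : Fin d → ℕ} (hi : i ∈ increasingPaths n d) :
    Function.Injective (pathPair n i) := fun _ _ h =>
  Fin.succ_injective _ ((mem_increasingPaths.1 hi).injective (congrArg Prod.snd h))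

lemma pathPair_mem_edges {i : Fin d → ℕ} (hi : i ∈ increasingPaths n d) (j : Fin (d + 1)) :
    pathPair n i j ∈ edges n := by
  have h := mem_increasingPaths.1 hi
  have hb : ∀ j, withEnds n i j ∈ Finset.Icc 1 n := fun j =>
    Finset.mem_Icc.2 ⟨by simpa using h.monotone (Fin.zero_le j),
      by simpa using h.monotone (Fin.le_last j)⟩
  exact Finset.mem_filter.2 ⟨Finset.mem_product.2 ⟨hb j.castSucc, hb j.succ⟩,
    h Fin.castSucc_lt_succ⟩

lemma withEnds_injective (n d : ℕ) :
    Function.Injective (withEnds n : (Fin d → ℕ) → Fin (d + 2) → ℕ) := by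
  intro i i' h
  ext a
  simpa using congrFun h a.castSucc.succ

/-- The positions of the edges of `i'` which belong to `i`. -/
def commonEdges (n : ℕ) {d : ℕ} (i i' : Fin d → ℕ) : Finset (Fin (d + 1)) :=
  Finset.univ.filter fun j => pathPair n i' j ∈ pathPairs n i

lemma card_pathPairs {i : Fin d → ℕ} (hi : i ∈ increasingPaths n d) :
    (pathPairs n i).card = d + 1 := by
  rw [pathPairs, Finset.card_image_of_injective _ (pathPair_injective hi), Finset.card_univ,
    Fintype.card_fin]

lemma card_pathPairs_union {i i' : Fin d → ℕ} (hi : i ∈ increasingPaths n d)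
    (hi' : i' ∈ increasingPaths n d) :
    (pathPairs n i ∪ pathPairs n i').card = (d + 1) + (d + 1 - (commonEdges n i i').card) := by
  have h : pathPairs n i' \ pathPairs n i = (commonEdges n i i')ᶜ.image (pathPair n i') := by
    ext e
    simp only [commonEdges, Finset.mem_sdiff, Finset.mem_image, Finset.mem_compl,
      Finset.mem_filter, Finset.mem_univ, true_and]
    constructor
    · rintro ⟨h1, h2⟩
      obtain ⟨j, -, rfl⟩ := Finset.mem_image.1 h1
      exact ⟨j, h2, rfl⟩
    · rintro ⟨j, h1, rfl⟩
      exact ⟨Finset.mem_image_of_mem _ (Finset.mem_univ j), h1⟩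
  rw [Finset.union_comm, ← Finset.card_sdiff_add_card, h,
    Finset.card_image_of_injective _ (pathPair_injective hi'),
    Finset.card_compl, Fintype.card_fin, card_pathPairs hi, add_comm]

lemma mem_range_of_mem_pathPairs {i : Fin d → ℕ} {e : ℕ × ℕ} (he : e ∈ pathPairs n i) :
    e.1 ∈ Finset.univ.image (withEnds n i) ∧ e.2 ∈ Finset.univ.image (withEnds n i) := by
  obtain ⟨j, -, rfl⟩ := Finset.mem_image.1 he
  exact ⟨Finset.mem_image_of_mem (withEnds n i) (Finset.mem_univ j.castSucc),
    Finset.mem_image_of_mem (withEnds n i) (Finset.mem_univ j.succ)⟩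

/-- All vertices of `i'` lie on `i`; the two vertex sets have the same size, hence coincide, and an
increasing sequence is determined by its range. -/
lemma eq_of_commonEdges_eq_univ {i i' : Fin d → ℕ} (hi : i ∈ increasingPaths n d)
    (hi' : i' ∈ increasingPaths n d) (h : commonEdges n i i' = Finset.univ) : i' = i := by
  have hm : ∀ j, pathPair n i' j ∈ pathPairs n i := fun j => by
    have hj : j ∈ commonEdges n i i' := h ▸ Finset.mem_univ j
    exact (Finset.mem_filter.1 hj).2
  have hsub : Finset.univ.image (withEnds n i') ⊆ Finset.univ.image (withEnds n i) := by
    intro v hv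
    obtain ⟨j, -, rfl⟩ := Finset.mem_image.1 hv
    induction j using Fin.cases with
    | zero => exact (mem_range_of_mem_pathPairs (hm 0)).1
    | succ j => exact (mem_range_of_mem_pathPairs (hm j)).2
  have hcard : ∀ {i : Fin d → ℕ}, i ∈ increasingPaths n d →
      (Finset.univ.image (withEnds n i)).card = d + 2 := fun hi => by
    rw [Finset.card_image_of_injective _ (mem_increasingPaths.1 hi).injective, Finset.card_univ,
      Fintype.card_fin]
  have heq := Finset.eq_of_subset_of_card_le hsub (by rw [hcard hi, hcard hi'])
  refine withEnds_injective n d ?_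
  rw [← StrictMono.range_inj (mem_increasingPaths.1 hi') (mem_increasingPaths.1 hi)]
  have := congrArg (fun s : Finset ℕ => (s : Set ℕ)) heq
  simpa using this

/-- Each shared edge pins one interior vertex of `i'` to the at most `d + 2` vertices of `i`, and
distinct shared edges can be made to pin distinct vertices. The other interior vertices have at most
`n` choices each. -/
lemma card_filter_commonEdges_le (i : Fin d → ℕ) (J : Finset (Fin (d + 1)))
    (hJ : J ≠ Finset.univ) :
    ((increasingPaths n d).filter fun i' => commonEdges n i i' = J).card ≤
      (d + 2) ^ J.card * n ^ (d - J.card) := by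
  obtain ⟨j₀, hj₀⟩ : ∃ j, j ∉ J := by
    by_contra h
    push Not at h
    exact hJ (Finset.eq_univ_iff_forall.2 h)
  set V := Finset.univ.image (withEnds n i) with hV
  -- The missing edge `j₀` makes the assignment injective and avoids the endpoints: an edge before
  -- `j₀` pins its right end, an edge after `j₀` its left end. `j₀.succAbove` is the inverse map
  -- from interior vertices to edges.
  set K : Finset (Fin d) := Finset.univ.filter fun a => j₀.succAbove a ∈ J with hK
  have hKcard : K.card = J.card := by
    rw [← Finset.card_image_of_injective K (Fin.succAbove_right_injective (p := j₀))]
    congr 1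
    ext j
    simp only [hK, Finset.mem_image, Finset.mem_filter, Finset.mem_univ, true_and]
    constructor
    · rintro ⟨a, ha, rfl⟩; exact ha
    · intro hj
      obtain ⟨a, rfl⟩ := Fin.exists_succAbove_eq (x := j) (y := j₀) (fun h => hj₀ (h ▸ hj))
      exact ⟨a, hj, rfl⟩
  have hVcard : V.card ≤ d + 2 := by
    refine Finset.card_image_le.trans_eq ?_
    simp
  have hsub : ((increasingPaths n d).filter fun i' => commonEdges n i i' = J) ⊆
      Fintype.piFinset fun a => if a ∈ K then V else Finset.Icc 1 n := by
    intro i' hi'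
    obtain ⟨h1, h2⟩ := Finset.mem_filter.1 hi'
    rw [Fintype.mem_piFinset]
    intro a
    split_ifs with ha
    · have h3 : j₀.succAbove a ∈ commonEdges n i i' := by
        rw [h2]; exact (Finset.mem_filter.1 ha).2
      have h4 := mem_range_of_mem_pathPairs (Finset.mem_filter.1 h3).2
      rcases lt_or_ge a.castSucc j₀ with hlt | hge
      · rw [Fin.succAbove_of_castSucc_lt _ _ hlt] at h4
        simpa [pathPair, hV] using h4.2
      · rw [Fin.succAbove_of_le_castSucc _ _ hge] at h4
        have h5 := h4.1
        rw [pathPair, ← Fin.succ_castSucc, withEnds_succ_castSucc] at h5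
        exact h5
    · exact (Fintype.mem_piFinset.1 (Finset.mem_filter.1 h1).1) a
  refine (Finset.card_le_card hsub).trans ?_
  rw [Fintype.card_piFinset]
  have : ∀ a, (if a ∈ K then V else Finset.Icc 1 n).card = if a ∈ K then V.card else n := by
    intro a; split_ifs <;> simp
  simp only [this]
  rw [Finset.prod_ite, Finset.prod_const, Finset.prod_const]
  have e1 : (Finset.univ.filter fun a => a ∈ K).card = J.card := by simp [hKcard]
  have e2 : (Finset.univ.filter fun a => ¬ a ∈ K).card = d - J.card := by
    have := Finset.card_compl K
    rw [hKcard, Fintype.card_fin] at this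
    rw [← this]
    congr 1
    ext a; simp
  rw [e1, e2]
  exact Nat.mul_le_mul_right _ (Nat.pow_le_pow_left hVcard _)

/-- The constant in the bound for the pairs of paths with a common edge. -/
def pairConst (d : ℕ) : ℝ := 2 ^ (d + 1) * (d + 2) ^ (d + 1)

/-- Sharing `a` edges costs a factor `n ^ a` in the count and saves `q ^ a` in the probability, so
relative to independent pairs the contribution is `(n q) ^ (-a)`. As `n q ≥ 1` and `a ≥ 1`, this is
at most `1 / (n q)`; the constant sums over the possible sets of shared positions. -/
lemma sum_common_edge_le {q : ℝ} (hq : 0 ≤ q) (hnq : 1 ≤ n * q) {i : Fin d → ℕ}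
    (hi : i ∈ increasingPaths n d) :
    (∑ i' ∈ increasingPaths n d with i' ≠ i ∧ ¬ Disjoint (pathPairs n i) (pathPairs n i'),
      q ^ (pathPairs n i ∪ pathPairs n i').card) * (n * q) ≤
      pairConst d * (n ^ d * q ^ (2 * (d + 1))) := by
  have hn0 : (0 : ℝ) ≤ n := Nat.cast_nonneg n
  set T : Finset (Finset (Fin (d + 1))) :=
    Finset.univ.filter fun J => J ≠ ∅ ∧ J ≠ Finset.univ with hT
  have hmaps : ∀ i' ∈ (increasingPaths n d).filter (fun i' => i' ≠ i ∧
      ¬ Disjoint (pathPairs n i) (pathPairs n i')), commonEdges n i i' ∈ T := by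
    intro i' hi'
    obtain ⟨h1, h2, h3⟩ := Finset.mem_filter.1 hi'
    refine Finset.mem_filter.2 ⟨Finset.mem_univ _, ?_, fun h =>
      h2 (eq_of_commonEdges_eq_univ hi h1 h)⟩
    rw [Finset.not_disjoint_iff] at h3
    obtain ⟨e, he, he'⟩ := h3
    obtain ⟨j, -, rfl⟩ := Finset.mem_image.1 he'
    exact Finset.ne_empty_of_mem (Finset.mem_filter.2 ⟨Finset.mem_univ j, he⟩)
  rw [← Finset.sum_fiberwise_of_maps_to hmaps, Finset.sum_mul]
  have hterm : ∀ J ∈ T, (∑ i' ∈ ((increasingPaths n d).filter (fun i' => i' ≠ i ∧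
      ¬ Disjoint (pathPairs n i) (pathPairs n i'))).filter (fun i' => commonEdges n i i' = J),
        q ^ (pathPairs n i ∪ pathPairs n i').card) * (n * q) ≤
      (d + 2) ^ (d + 1) * (n ^ d * q ^ (2 * (d + 1))) := by
    intro J hJ
    obtain ⟨-, hJ0, hJ1⟩ := Finset.mem_filter.1 hJ
    set a := J.card with ha
    have ha1 : 1 ≤ a := Finset.card_pos.2 (Finset.nonempty_iff_ne_empty.2 hJ0)
    have ha2 : a ≤ d := by
      have := Finset.card_lt_card (Finset.ssubset_univ_iff.2 hJ1)
      rw [Finset.card_univ, Fintype.card_fin] at this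
      omega
    have hsum : ∑ i' ∈ ((increasingPaths n d).filter (fun i' => i' ≠ i ∧
        ¬ Disjoint (pathPairs n i) (pathPairs n i'))).filter (fun i' => commonEdges n i i' = J),
          q ^ (pathPairs n i ∪ pathPairs n i').card ≤
        (d + 2) ^ a * n ^ (d - a) * q ^ ((d + 1) + (d + 1 - a)) := by
      rw [Finset.sum_congr rfl (g := fun _ => q ^ ((d + 1) + (d + 1 - a)))]
      · rw [Finset.sum_const, nsmul_eq_mul]
        refine mul_le_mul_of_nonneg_right ?_ (pow_nonneg hq _)
        have h1 := card_filter_commonEdges_le (n := n) i J hJ1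
        have h2 : (((increasingPaths n d).filter (fun i' => i' ≠ i ∧
            ¬ Disjoint (pathPairs n i) (pathPairs n i'))).filter
              (fun i' => commonEdges n i i' = J)).card ≤
            ((increasingPaths n d).filter fun i' => commonEdges n i i' = J).card :=
          Finset.card_le_card (Finset.filter_subset_filter _ (Finset.filter_subset _ _))
        exact_mod_cast h2.trans h1
      · intro i' hi'
        obtain ⟨h1, h2⟩ := Finset.mem_filter.1 hi'
        rw [card_pathPairs_union hi (Finset.mem_filter.1 h1).1, h2]
    have hpow : (n : ℝ) ^ (d - a) * q ^ ((d + 1) + (d + 1 - a)) * (n * q) ≤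
        n ^ d * q ^ (2 * (d + 1)) := by
      have h1 : (n : ℝ) * q ≤ (n * q) ^ a := le_self_pow₀ hnq (by omega)
      calc (n : ℝ) ^ (d - a) * q ^ ((d + 1) + (d + 1 - a)) * (n * q)
          ≤ n ^ (d - a) * q ^ ((d + 1) + (d + 1 - a)) * (n * q) ^ a := by gcongr
        _ = (n ^ (d - a) * n ^ a) * (q ^ ((d + 1) + (d + 1 - a)) * q ^ a) := by
          rw [mul_pow]; ring
        _ = _ := by
          rw [← pow_add, ← pow_add]
          congr 2 <;> omega
    have hd : ((d : ℝ) + 2) ^ a ≤ (d + 2) ^ (d + 1) :=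
      pow_le_pow_right₀ (by have : (0 : ℝ) ≤ d := Nat.cast_nonneg d
                            linarith) (by omega)
    calc _ ≤ ((d : ℝ) + 2) ^ a * n ^ (d - a) * q ^ ((d + 1) + (d + 1 - a)) * (n * q) := by
          gcongr
      _ = (d + 2) ^ a * (n ^ (d - a) * q ^ ((d + 1) + (d + 1 - a)) * (n * q)) := by ring
      _ ≤ _ := by gcongr
  refine (Finset.sum_le_sum hterm).trans ?_
  rw [Finset.sum_const, nsmul_eq_mul, pairConst, mul_assoc]
  have hTc : (T.card : ℝ) ≤ 2 ^ (d + 1) := by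
    have := Finset.card_le_univ T
    rw [Fintype.card_finset, Fintype.card_fin] at this
    exact_mod_cast this
  gcongr

lemma sum_sum_common_edge_le {q : ℝ} (hq : 0 ≤ q) (hnq : 1 ≤ n * q) :
    (∑ i ∈ increasingPaths n d,
      ∑ i' ∈ increasingPaths n d with i' ≠ i ∧ ¬ Disjoint (pathPairs n i) (pathPairs n i'),
        q ^ (pathPairs n i ∪ pathPairs n i').card) * (n * q) ≤
      pairConst d * (n ^ d * q ^ (d + 1)) ^ 2 := by
  have hC : 0 ≤ pairConst d := by unfold pairConst; positivity
  rw [Finset.sum_mul]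
  refine (Finset.sum_le_sum fun i hi => sum_common_edge_le hq hnq hi).trans ?_
  rw [Finset.sum_const, nsmul_eq_mul]
  have h1 : ((increasingPaths n d).card : ℝ) ≤ n ^ d := by
    exact_mod_cast card_increasingPaths_le n d
  calc ((increasingPaths n d).card : ℝ) * (pairConst d * (n ^ d * q ^ (2 * (d + 1))))
      ≤ n ^ d * (pairConst d * (n ^ d * q ^ (2 * (d + 1)))) := by gcongr
    _ = _ := by ring

end PathPairs

/-! ### Path counts in the random graph -/

section RandomGraph

variable {n d : ℕ}

/-- The set of the edges of a path, as a set of potential edges of the random graph. -/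
def edgeSet (n : ℕ) {d : ℕ} (i : Fin d → ℕ) : Finset (edges n) :=
  (pathPairs n i).subtype (· ∈ edges n)

lemma pathPairs_subset_edges {i : Fin d → ℕ} (hi : i ∈ increasingPaths n d) :
    ∀ e ∈ pathPairs n i, e ∈ edges n := by
  intro e he
  obtain ⟨j, -, rfl⟩ := Finset.mem_image.1 he
  exact pathPair_mem_edges hi j

lemma edgeSet_union (i i' : Fin d → ℕ) :
    edgeSet n i ∪ edgeSet n i' = (pathPairs n i ∪ pathPairs n i').subtype (· ∈ edges n) := by
  ext e
  simp [edgeSet]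

lemma disjoint_edgeSet {i i' : Fin d → ℕ} (hi : i ∈ increasingPaths n d) :
    Disjoint (edgeSet n i) (edgeSet n i') ↔ Disjoint (pathPairs n i) (pathPairs n i') := by
  simp only [Finset.disjoint_left, edgeSet, Finset.mem_subtype]
  exact ⟨fun h e he => h (a := ⟨e, pathPairs_subset_edges hi e he⟩) he, fun h e he => h he⟩

lemma allOpen_edgeSet {i : Fin d → ℕ} (hi : i ∈ increasingPaths n d) (ω : edges n → Bool) :
    ω ∈ allOpen (edgeSet n i) ↔
      ∀ j : Fin (d + 1), (toDigraph ω).Adj (withEnds n i j.castSucc) (withEnds n i j.succ) := by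
  constructor
  · exact fun h j => ⟨pathPair_mem_edges hi j, h _ (Finset.mem_subtype.2
      (Finset.mem_image_of_mem _ (Finset.mem_univ j)))⟩
  · rintro h ⟨e, he⟩ hei
    obtain ⟨j, -, rfl⟩ := Finset.mem_image.1 (Finset.mem_subtype.1 hei)
    exact (h j).2

/-- Edges of the graph increase, so a path is automatically an increasing sequence and is determined
by its interior vertices. -/
lemma hasPath_iff (ω : edges n → Bool) :
    HasPath (toDigraph ω) 1 n (d + 1) ↔
      ∃ i ∈ increasingPaths n d, ω ∈ allOpen (edgeSet n i) := by
  constructor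
  · rintro ⟨ρ, h0, h1, h⟩
    have hρ : withEnds n (fun a : Fin d => ρ a.castSucc.succ) = ρ := by
      funext j
      induction j using Fin.cases with
      | zero => simp [h0]
      | succ j =>
        induction j using Fin.lastCases with
        | last => rw [Fin.succ_last, withEnds_last, h1]
        | cast a => simp
    have hi : (fun a : Fin d => ρ a.castSucc.succ) ∈ increasingPaths n d := by
      rw [mem_increasingPaths, hρ, Fin.strictMono_iff_lt_succ]
      exact fun j => (Finset.mem_filter.1 (h j).1).2
    refine ⟨_, hi, (allOpen_edgeSet hi ω).2 ?_⟩
    rw [hρ]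
    exact h
  · rintro ⟨i, hi, h⟩
    exact ⟨withEnds n i, withEnds_zero n i, withEnds_last n i, (allOpen_edgeSet hi ω).1 h⟩

lemma setOf_not_hasPath (n d : ℕ) :
    {ω : edges n → Bool | ¬ HasPath (toDigraph ω) 1 n (d + 1)} =
      noneOpen (increasingPaths n d) (edgeSet n) := by
  ext ω
  simp only [Set.mem_ofPred_eq, hasPath_iff, noneOpen]
  push Not
  rfl

variable (f : ℝ → ℝ → ℝ) (γ : ℝ)

instance : IsProbabilityMeasure (graphLaw f γ n) := by
  unfold graphLaw; infer_instance

lemma bernoulliMeasure_real_true (p : unitInterval) :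
    (bernoulliMeasure true false p).real {true} = p := by
  classical
  rw [bernoulliMeasure_real_apply p (measurableSet_singleton true)]
  simp

lemma graphLaw_real_allOpen (S : Finset (edges n)) :
    (graphLaw f γ n).real (allOpen S) = ∏ e ∈ S, (edgeProb f γ n e.1 : ℝ) := by
  rw [graphLaw, pi_real_allOpen]
  simp only [bernoulliMeasure_real_true]

lemma graphLaw_real_allOpen_edgeSet {i : Fin d → ℕ} (hi : i ∈ increasingPaths n d) :
    (graphLaw f γ n).real (allOpen (edgeSet n i)) =
      ∏ j : Fin (d + 1), (edgeProb f γ n (pathPair n i j) : ℝ) := by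
  rw [graphLaw_real_allOpen, edgeSet,
    Finset.prod_subtype_of_mem (fun e => (edgeProb f γ n e : ℝ)) (pathPairs_subset_edges hi),
    pathPairs, Finset.prod_image fun _ _ _ _ h => pathPair_injective hi h]

/-- The expected number of paths with `d + 1` edges from `1` to `n`. -/
def pathMean (n d : ℕ) : ℝ :=
  ∑ i ∈ increasingPaths n d, (graphLaw f γ n).real (allOpen (edgeSet n i))

/-- The sum of the probabilities of joint presence, over the pairs of distinct paths which have a
common edge. -/
def pairMean (n d : ℕ) : ℝ :=
  ∑ i ∈ increasingPaths n d,
    ∑ i' ∈ increasingPaths n d with i' ≠ i ∧ ¬ Disjoint (edgeSet n i) (edgeSet n i'),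
      (graphLaw f γ n).real (allOpen (edgeSet n i ∪ edgeSet n i'))

variable {f γ} {q : ℝ}

lemma graphLaw_real_allOpen_edgeSet_le (hq : ∀ e ∈ edges n, (edgeProb f γ n e : ℝ) ≤ q)
    {i : Fin d → ℕ} (hi : i ∈ increasingPaths n d) :
    (graphLaw f γ n).real (allOpen (edgeSet n i)) ≤ q ^ (d + 1) := by
  rw [graphLaw_real_allOpen_edgeSet f γ hi]
  refine (Finset.prod_le_prod (fun j _ => (edgeProb f γ n (pathPair n i j)).2.1)
    (fun j _ => hq _ (pathPair_mem_edges hi j))).trans_eq ?_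
  simp

lemma pathMean_le (hq : ∀ e ∈ edges n, (edgeProb f γ n e : ℝ) ≤ q) (hq0 : 0 ≤ q) :
    pathMean f γ n d ≤ n ^ d * q ^ (d + 1) := by
  refine (Finset.sum_le_sum fun i hi => graphLaw_real_allOpen_edgeSet_le hq hi).trans ?_
  rw [Finset.sum_const, nsmul_eq_mul]
  have h1 : ((increasingPaths n d).card : ℝ) ≤ n ^ d := by
    exact_mod_cast card_increasingPaths_le n d
  gcongr

lemma pairMean_mul_le (hq : ∀ e ∈ edges n, (edgeProb f γ n e : ℝ) ≤ q) (hq0 : 0 ≤ q)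
    (hnq : 1 ≤ n * q) :
    pairMean f γ n d * (n * q) ≤ pairConst d * (n ^ d * q ^ (d + 1)) ^ 2 := by
  refine le_trans (mul_le_mul_of_nonneg_right ?_ (by linarith)) (sum_sum_common_edge_le hq0 hnq)
  refine Finset.sum_le_sum fun i hi => ?_
  rw [Finset.filter_congr (q := fun i' => i' ≠ i ∧ ¬ Disjoint (pathPairs n i) (pathPairs n i'))
    fun i' _ => by rw [disjoint_edgeSet hi]]
  refine Finset.sum_le_sum fun i' hi' => ?_
  have hsub : ∀ e ∈ pathPairs n i ∪ pathPairs n i', e ∈ edges n := fun e he =>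
    (Finset.mem_union.1 he).elim (pathPairs_subset_edges hi e)
      (pathPairs_subset_edges (Finset.mem_filter.1 hi').1 e)
  rw [edgeSet_union, graphLaw_real_allOpen,
    Finset.prod_subtype_of_mem (fun e => (edgeProb f γ n e : ℝ)) hsub]
  refine (Finset.prod_le_prod (fun e _ => (edgeProb f γ n e).2.1) fun e he =>
    hq e (hsub e he)).trans_eq ?_
  simp

lemma pathMean_eq (h : ∀ e ∈ edges n, (edgeProb f γ n e : ℝ) =
      f ((e.1 : ℝ) / n) ((e.2 : ℝ) / n) / (n : ℝ) ^ γ) :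
    pathMean f γ n d = (∑ i ∈ increasingPaths n d, gridProduct f n i) / ((n : ℝ) ^ γ) ^ (d + 1) := by
  rw [pathMean, Finset.sum_div]
  refine Finset.sum_congr rfl fun i hi => ?_
  rw [graphLaw_real_allOpen_edgeSet f γ hi,
    Finset.prod_congr rfl fun j _ => h _ (pathPair_mem_edges hi j), Finset.prod_div_distrib]
  simp [gridProduct, pathPair]

lemma div_mem_Ioc_of_mem_edges {e : ℕ × ℕ} (he : e ∈ edges n) :
    (e.1 : ℝ) / n ∈ Set.Ioc (0 : ℝ) 1 ∧ (e.2 : ℝ) / n ∈ Set.Ioc (0 : ℝ) 1 := by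
  obtain ⟨h, -⟩ := Finset.mem_filter.1 he
  obtain ⟨h1, h2⟩ := Finset.mem_product.1 h
  have key : ∀ v ∈ Finset.Icc 1 n, (v : ℝ) / n ∈ Set.Ioc (0 : ℝ) 1 := by
    intro v hv
    obtain ⟨hv1, hv2⟩ := Finset.mem_Icc.1 hv
    have hv0 : (0 : ℝ) < v := by exact_mod_cast hv1
    have hv2' : (v : ℝ) ≤ n := by exact_mod_cast hv2
    exact ⟨div_pos hv0 (by linarith), div_le_one_of_le₀ hv2' (by linarith)⟩
  exact ⟨key _ h1, key _ h2⟩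

lemma edgeProb_le {M : ℝ} (hM0 : 0 ≤ M)
    (hM : ∀ x ∈ Set.Ioc (0 : ℝ) 1, ∀ y ∈ Set.Ioc (0 : ℝ) 1, |f x y| ≤ M) :
    ∀ e ∈ edges n, (edgeProb f γ n e : ℝ) ≤ M / (n : ℝ) ^ γ := by
  intro e he
  have hγ : (0 : ℝ) ≤ (n : ℝ) ^ γ := Real.rpow_nonneg (Nat.cast_nonneg n) _
  obtain ⟨h1, h2⟩ := div_mem_Ioc_of_mem_edges he
  rw [edgeProb, Set.coe_projIcc]
  refine max_le (div_nonneg hM0 hγ) ((min_le_right _ _).trans ?_)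
  exact div_le_div_of_nonneg_right ((le_abs_self _).trans (hM _ h1 _ h2)) hγ

lemma edgeProb_eq {M : ℝ}
    (hf : ∀ x ∈ Set.Icc (0 : ℝ) 1, ∀ y ∈ Set.Icc (0 : ℝ) 1, 0 ≤ f x y)
    (hM : ∀ x ∈ Set.Ioc (0 : ℝ) 1, ∀ y ∈ Set.Ioc (0 : ℝ) 1, |f x y| ≤ M)
    (h1 : M / (n : ℝ) ^ γ ≤ 1) :
    ∀ e ∈ edges n, (edgeProb f γ n e : ℝ) =
      f ((e.1 : ℝ) / n) ((e.2 : ℝ) / n) / (n : ℝ) ^ γ := by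
  intro e he
  have hγ : (0 : ℝ) ≤ (n : ℝ) ^ γ := Real.rpow_nonneg (Nat.cast_nonneg n) _
  obtain ⟨he1, he2⟩ := div_mem_Ioc_of_mem_edges he
  rw [edgeProb, Set.coe_projIcc, min_eq_right, max_eq_right]
  · exact div_nonneg (hf _ (Set.Ioc_subset_Icc_self he1) _ (Set.Ioc_subset_Icc_self he2)) hγ
  · exact (div_le_div_of_nonneg_right ((le_abs_self _).trans (hM _ he1 _ he2)) hγ).trans h1

/-- The probability that there is no path with `m` edges from `1` to `n`. -/
def noPathProb (f : ℝ → ℝ → ℝ) (γ : ℝ) (n m : ℕ) : ℝ :=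
  (graphLaw f γ n).real {ω | ¬ HasPath (toDigraph ω) 1 n m}

lemma noPathProb_le_one {m : ℕ} : noPathProb f γ n m ≤ 1 := measureReal_le_one

lemma noPathProb_le_exp :
    noPathProb f γ n (d + 1) ≤ Real.exp (-pathMean f γ n d + pairMean f γ n d) := by
  rw [noPathProb, setOf_not_hasPath]
  exact janson _ _ _

/-- Each factor of the Harris bound satisfies `1 - p ≥ exp (-p / (1 - p)) ≥ exp (-p / (1 - q))`,
because a path is no likelier than one of its edges. -/
lemma exp_le_noPathProb (hq : ∀ e ∈ edges n, (edgeProb f γ n e : ℝ) ≤ q) (hq0 : 0 ≤ q)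
    (hq1 : q < 1) :
    Real.exp (-(pathMean f γ n d / (1 - q))) ≤ noPathProb f γ n (d + 1) := by
  rw [noPathProb, setOf_not_hasPath]
  refine le_trans ?_ (prod_le_noneOpen _ _ _)
  rw [pathMean, Finset.sum_div, ← Finset.sum_neg_distrib, Real.exp_sum]
  refine Finset.prod_le_prod (fun _ _ => (Real.exp_pos _).le) fun i hi => ?_
  have hp0 : 0 ≤ (graphLaw f γ n).real (allOpen (edgeSet n i)) := measureReal_nonneg
  have hpq : (graphLaw f γ n).real (allOpen (edgeSet n i)) ≤ q :=
    (graphLaw_real_allOpen_edgeSet_le hq hi).trans (pow_le_of_le_one hq0 hq1.le (by omega))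
  change Real.exp (-((graphLaw f γ n).real (allOpen (edgeSet n i)) / (1 - q))) ≤
    1 - (graphLaw f γ n).real (allOpen (edgeSet n i))
  set p := (graphLaw f γ n).real (allOpen (edgeSet n i)) with hp
  have h1 : 0 < 1 - p := by linarith
  rw [← Real.le_log_iff_exp_le h1]
  refine le_trans ?_ (Real.one_sub_inv_le_log_of_pos h1)
  have h2 : 1 - (1 - p)⁻¹ = -(p / (1 - p)) := by field_simp; ring
  rw [h2, neg_le_neg_iff]
  exact div_le_div_of_nonneg_left hp0 (by linarith) (by linarith)

lemma noPathProb_mul_sq_le :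
    noPathProb f γ n (d + 1) * pathMean f γ n d ^ 2 ≤ pathMean f γ n d + pairMean f γ n d := by
  rw [noPathProb, setOf_not_hasPath]
  refine (noneOpen_mul_sq_le _ _ _).trans ?_
  rw [pathMean, pairMean, ← Finset.sum_add_distrib]
  refine Finset.sum_le_sum fun i hi => ?_
  -- In the second moment a path also overlaps itself; these diagonal terms sum to `pathMean`.
  have hsub : (increasingPaths n d).filter (fun i' => ¬ Disjoint (edgeSet n i) (edgeSet n i')) ⊆
      insert i ((increasingPaths n d).filter
        fun i' => i' ≠ i ∧ ¬ Disjoint (edgeSet n i) (edgeSet n i')) := by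
    intro i' hi'
    obtain ⟨h1, h2⟩ := Finset.mem_filter.1 hi'
    by_cases h : i' = i
    · exact h ▸ Finset.mem_insert_self _ _
    · exact Finset.mem_insert_of_mem (Finset.mem_filter.2 ⟨h1, h, h2⟩)
  refine (Finset.sum_le_sum_of_subset_of_nonneg hsub fun _ _ _ => measureReal_nonneg).trans ?_
  rw [Finset.sum_insert (by simp), Finset.union_self]
  exact le_rfl

lemma one_sub_noPathProb_le : 1 - noPathProb f γ n (d + 1) ≤ pathMean f γ n d := by
  have h1 : 1 - noPathProb f γ n (d + 1) =
      (graphLaw f γ n).real (noneOpen (increasingPaths n d) (edgeSet n))ᶜ := by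
    rw [noPathProb, setOf_not_hasPath, probReal_compl_eq_one_sub (measurableSet_config _)]
  rw [h1]
  have h2 : (noneOpen (increasingPaths n d) (edgeSet n))ᶜ ⊆
      ⋃ i ∈ increasingPaths n d, allOpen (edgeSet n i) := by
    intro ω hω
    simp only [noneOpen, Set.mem_compl_iff, Set.mem_ofPred_eq, not_forall, not_not] at hω
    obtain ⟨i, hi, h⟩ := hω
    simp only [Set.mem_iUnion]
    exact ⟨i, hi, h⟩
  exact (measureReal_mono h2 (measure_ne_top _ _)).trans (measureReal_biUnion_finset_le _ _)

end RandomGraph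

/-! ### From path events to the law of the shortest length -/

section ShortestPath

lemma shortestPathLength_eq_iff {V : Type*} (G : Digraph V) (a b : V) (m : ℕ) :
    shortestPathLength G a b = (m : ℕ∞) ↔ HasPath G a b m ∧ ∀ j < m, ¬ HasPath G a b j := by
  classical
  have key : ∀ m, HasPath G a b m → (∀ j < m, ¬ HasPath G a b j) →
      shortestPathLength G a b = (m : ℕ∞) := fun m h1 h2 =>
    le_antisymm (iInf₂_le m h1) (le_iInf₂ fun j hj => by
      rw [Nat.cast_le]
      by_contra hlt
      exact h2 j (not_le.1 hlt) hj)
  refine ⟨fun h => ?_, fun h => key m h.1 h.2⟩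
  by_cases hex : ∃ j, HasPath G a b j
  · have h1 := key _ (Nat.find_spec hex) fun j hj => Nat.find_min hex hj
    rw [h, Nat.cast_inj] at h1
    rw [h1]
    exact ⟨Nat.find_spec hex, fun j hj => Nat.find_min hex hj⟩
  · push Not at hex
    have h1 : shortestPathLength G a b = ⊤ := by
      simp [shortestPathLength, hex]
    rw [h1] at h
    exact absurd h.symm (ENat.natCast_ne_top m)

variable {f : ℝ → ℝ → ℝ} {γ : ℝ}

lemma noPathProb_eq (n m : ℕ) : (graphLaw f γ n).real {ω | HasPath (toDigraph ω) 1 n m} =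
    1 - noPathProb f γ n m := by
  have h := probReal_compl_eq_one_sub (μ := graphLaw f γ n)
    (measurableSet_config {ω | HasPath (toDigraph ω) 1 n m})
  have h2 : {ω : edges n → Bool | HasPath (toDigraph ω) 1 n m}ᶜ =
    {ω | ¬ HasPath (toDigraph ω) 1 n m} := rfl
  rw [h2] at h
  rw [noPathProb, h]
  ring

lemma shorter_real_le (n m : ℕ) :
    (graphLaw f γ n).real {ω | ∃ j < m, HasPath (toDigraph ω) 1 n j} ≤
      ∑ j ∈ Finset.range m, (1 - noPathProb f γ n j) := by
  have h : {ω : edges n → Bool | ∃ j < m, HasPath (toDigraph ω) 1 n j} =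
      ⋃ j ∈ Finset.range m, {ω | HasPath (toDigraph ω) 1 n j} := by
    ext ω; simp
  rw [h]
  refine (measureReal_biUnion_finset_le _ _).trans_eq ?_
  simp only [noPathProb_eq]

lemma probLength_le_one_sub (n m : ℕ) : probLength f γ n m ≤ 1 - noPathProb f γ n m := by
  rw [← noPathProb_eq]
  exact measureReal_mono fun ω hω => ((shortestPathLength_eq_iff _ _ _ _).1 hω).1

lemma one_sub_le_probLength_add (n m : ℕ) :
    1 - noPathProb f γ n m ≤
      probLength f γ n m + ∑ j ∈ Finset.range m, (1 - noPathProb f γ n j) := by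
  rw [← noPathProb_eq]
  refine le_trans ?_ (add_le_add le_rfl (shorter_real_le n m))
  refine le_trans (measureReal_mono ?_) (measureReal_union_le _ _)
  intro ω hω
  by_cases h : ∃ j < m, HasPath (toDigraph ω) 1 n j
  · exact Or.inr h
  · push Not at h
    exact Or.inl ((shortestPathLength_eq_iff _ _ _ _).2 ⟨hω, h⟩)

lemma probLength_succ_le (n m : ℕ) : probLength f γ n (m + 1) ≤ noPathProb f γ n m :=
  measureReal_mono fun _ hω => ((shortestPathLength_eq_iff _ _ _ _).1 hω).2 m (Nat.lt_succ_self m)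

/-- If no path has `m` edges, the shortest length can differ from `m + 1` only because of a shorter
path or because there is none with `m + 1` edges. -/
lemma noPathProb_le_probLength_succ_add (n m : ℕ) :
    noPathProb f γ n m ≤ probLength f γ n (m + 1) +
      (∑ j ∈ Finset.range m, (1 - noPathProb f γ n j) + noPathProb f γ n (m + 1)) := by
  refine le_trans ?_ (add_le_add le_rfl (add_le_add (shorter_real_le n m) le_rfl))
  refine le_trans (measureReal_mono ?_) ((measureReal_union_le _ _).trans
    (add_le_add le_rfl (measureReal_union_le _ _)))
  intro ω hω
  by_cases h : ∃ j < m, HasPath (toDigraph ω) 1 n j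
  · exact Or.inr (Or.inl h)
  · by_cases h' : HasPath (toDigraph ω) 1 n (m + 1)
    · push Not at h
      refine Or.inl ((shortestPathLength_eq_iff _ _ _ _).2 ⟨h', fun j hj => ?_⟩)
      rcases Nat.lt_succ_iff_lt_or_eq.1 hj with hj | rfl
      · exact h j hj
      · exact hω
    · exact Or.inr (Or.inr h')

end ShortestPath

/-! ### Asymptotics of the moments at the scale `n ^ (1 / k)` -/

section Asymptotics

/-- The scale `n ^ (1 / k)`. -/
def scale (k n : ℕ) : ℝ := (n : ℝ) ^ (1 / (k : ℝ))

variable {k n : ℕ}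

lemma scale_pos (hn : 0 < n) : 0 < scale k n := Real.rpow_pos_of_pos (by exact_mod_cast hn) _

lemma scale_pow (hk : 2 ≤ k) (n : ℕ) : scale k n ^ k = n := by
  rw [scale, one_div]
  exact Real.rpow_inv_natCast_pow (Nat.cast_nonneg n) (by omega)

lemma tendsto_scale (hk : 2 ≤ k) : Tendsto (scale k) atTop atTop := by
  have hk' : (0 : ℝ) < k := by exact_mod_cast (by omega : 0 < k)
  exact (tendsto_rpow_atTop (one_div_pos.2 hk')).comp tendsto_natCast_atTop_atTop

lemma rpow_eq_div_scale (hn : 0 < n) : (n : ℝ) ^ (1 - 1 / (k : ℝ)) = n / scale k n := by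
  rw [Real.rpow_sub (by exact_mod_cast hn), Real.rpow_one, scale]

lemma tendsto_div_rpow (hk : 2 ≤ k) (M : ℝ) :
    Tendsto (fun n : ℕ => M / (n : ℝ) ^ (1 - 1 / (k : ℝ))) atTop (𝓝 0) := by
  have hk' : (1 : ℝ) < k := by exact_mod_cast hk
  have h : 0 < 1 - 1 / (k : ℝ) := by
    rw [sub_pos, div_lt_one (by linarith)]; exact hk'
  exact Tendsto.const_div_atTop ((tendsto_rpow_atTop h).comp tendsto_natCast_atTop_atTop) M

/-- The value of the exponent `γ = 1 - 1 / k`. -/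
abbrev pathExponent (k : ℕ) : ℝ := 1 - 1 / (k : ℝ)

lemma natCast_mul_div_rpow (hn : 0 < n) (M : ℝ) :
    n * (M / (n : ℝ) ^ pathExponent k) = M * scale k n := by
  have hn' : (n : ℝ) ≠ 0 := by exact_mod_cast hn.ne'
  have := (scale_pos (k := k) hn).ne'
  rw [rpow_eq_div_scale hn]
  field_simp

lemma natCast_pow_mul_div_rpow_pow (hn : 0 < n) (M : ℝ) (d : ℕ) :
    (n : ℝ) ^ d * (M / (n : ℝ) ^ pathExponent k) ^ (d + 1) = M ^ (d + 1) * (scale k n ^ (d + 1) / n) := by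
  have hn' : (n : ℝ) ≠ 0 := by exact_mod_cast hn.ne'
  have := (scale_pos (k := k) hn).ne'
  rw [rpow_eq_div_scale hn, div_pow, div_pow]
  field_simp
  ring

variable {f : ℝ → ℝ → ℝ} {M : ℝ}

/-- The Riemann sums of the path integrals. -/
def pathSum (f : ℝ → ℝ → ℝ) (n d : ℕ) : ℝ :=
  (∑ i ∈ increasingPaths n d, gridProduct f n i) / (n : ℝ) ^ d

lemma eventually_pathMean_eq (hk : 2 ≤ k)
    (hf : ∀ x ∈ Set.Icc (0 : ℝ) 1, ∀ y ∈ Set.Icc (0 : ℝ) 1, 0 ≤ f x y)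
    (hM : ∀ x ∈ Set.Ioc (0 : ℝ) 1, ∀ y ∈ Set.Ioc (0 : ℝ) 1, |f x y| ≤ M) (d : ℕ) :
    ∀ᶠ n : ℕ in atTop,
      pathMean f (pathExponent k) n d = pathSum f n d * (scale k n ^ (d + 1) / n) := by
  filter_upwards [(tendsto_div_rpow hk M).eventually_le_const one_pos, eventually_gt_atTop 0]
    with n h1 hn
  have hn' : (n : ℝ) ≠ 0 := by exact_mod_cast hn.ne'
  have := (scale_pos (k := k) hn).ne'
  rw [pathMean_eq (edgeProb_eq hf hM h1), pathSum, rpow_eq_div_scale hn, div_pow]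
  field_simp
  ring

lemma pathMean_le_scale (hM0 : 0 < M)
    (hM : ∀ x ∈ Set.Ioc (0 : ℝ) 1, ∀ y ∈ Set.Ioc (0 : ℝ) 1, |f x y| ≤ M)
    (hn : 0 < n) (d : ℕ) :
    pathMean f (pathExponent k) n d ≤ M ^ (d + 1) * (scale k n ^ (d + 1) / n) := by
  rw [← natCast_pow_mul_div_rpow_pow hn]
  exact pathMean_le (edgeProb_le hM0.le hM)
    (div_nonneg hM0.le (Real.rpow_nonneg (Nat.cast_nonneg n) _))

lemma eventually_pairMean_le (hk : 2 ≤ k) (hM0 : 0 < M)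
    (hM : ∀ x ∈ Set.Ioc (0 : ℝ) 1, ∀ y ∈ Set.Ioc (0 : ℝ) 1, |f x y| ≤ M)
    (d : ℕ) : ∀ᶠ n : ℕ in atTop, pairMean f (pathExponent k) n d ≤
      pairConst d * (M ^ (d + 1) * (scale k n ^ (d + 1) / n)) ^ 2 / (M * scale k n) := by
  filter_upwards [((tendsto_scale hk).const_mul_atTop hM0).eventually_ge_atTop 1,
    eventually_gt_atTop 0] with n h1 hn
  have h2 : 0 < M * scale k n := mul_pos hM0 (scale_pos hn)
  rw [le_div_iff₀ h2, ← natCast_pow_mul_div_rpow_pow hn, ← natCast_mul_div_rpow hn]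
  rw [← natCast_mul_div_rpow hn] at h1
  exact pairMean_mul_le (edgeProb_le hM0.le hM)
    (div_nonneg hM0.le (Real.rpow_nonneg (Nat.cast_nonneg n) _)) h1

/-- Paths with less than `k` edges are absent with probability tending to one. -/
lemma tendsto_one_sub_noPathProb_of_lt (hk : 2 ≤ k) (hM0 : 0 < M)
    (hM : ∀ x ∈ Set.Ioc (0 : ℝ) 1, ∀ y ∈ Set.Ioc (0 : ℝ) 1, |f x y| ≤ M)
    {j : ℕ} (hj : j < k) :
    Tendsto (fun n => 1 - noPathProb f (pathExponent k) n j) atTop (𝓝 0) := by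
  cases j with
  | zero =>
    refine tendsto_const_nhds.congr' ?_
    filter_upwards [eventually_gt_atTop 1] with n hn
    have : {ω : edges n → Bool | ¬ HasPath (toDigraph ω) 1 n 0} = Set.univ := by
      refine Set.eq_univ_of_forall fun ω => ?_
      rintro ⟨ρ, h0, h1, -⟩
      rw [Fin.last_zero, h0] at h1
      omega
    rw [noPathProb, this, probReal_univ, sub_self]
  | succ d =>
    refine squeeze_zero' (Eventually.of_forall fun n => sub_nonneg.2 noPathProb_le_one)
      (g := fun n => M ^ (d + 1) / scale k n) ?_ (Tendsto.const_div_atTop (tendsto_scale hk) _)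
    filter_upwards [eventually_gt_atTop 0, (tendsto_scale hk).eventually_ge_atTop 1] with n hn h1
    refine one_sub_noPathProb_le.trans ((pathMean_le_scale hM0 hM hn d).trans ?_)
    have ht := scale_pos (k := k) hn
    rw [div_eq_mul_one_div (M ^ (d + 1))]
    refine mul_le_mul_of_nonneg_left ?_ (pow_nonneg hM0.le _)
    have hn' : (0 : ℝ) < n := by exact_mod_cast hn
    rw [div_le_div_iff₀ hn' ht, one_mul, ← pow_succ]
    -- A path at least one edge too short loses at least one factor of the scale, since `scale k n ^
    -- k = n`.
    calc scale k n ^ (d + 1 + 1) ≤ scale k n ^ k := pow_le_pow_right₀ h1 hj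
      _ = n := scale_pow hk n

/-- **Poisson approximation**: the probability that there is no path with `k` edges. -/
lemma tendsto_noPathProb (hk : 2 ≤ k) (hM0 : 0 < M)
    (hM : ∀ x ∈ Set.Ioc (0 : ℝ) 1, ∀ y ∈ Set.Ioc (0 : ℝ) 1, |f x y| ≤ M)
    (hf : ∀ x ∈ Set.Icc (0 : ℝ) 1, ∀ y ∈ Set.Icc (0 : ℝ) 1, 0 ≤ f x y)
    {c : ℝ} (hc : Tendsto (fun n => pathSum f n (k - 1)) atTop (𝓝 c)) :
    Tendsto (fun n => noPathProb f (pathExponent k) n k) atTop (𝓝 (Real.exp (-c))) := by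
  obtain ⟨d, rfl⟩ : ∃ d, k = d + 1 := ⟨k - 1, by omega⟩
  rw [Nat.add_sub_cancel] at hc
  have hs : ∀ n : ℕ, 0 < n → scale (d + 1) n ^ (d + 1) / n = 1 := by
    intro n hn
    rw [scale_pow hk, div_self (by exact_mod_cast hn.ne')]
  have hmean : Tendsto (fun n => pathMean f (pathExponent (d + 1)) n d) atTop (𝓝 c) := by
    refine hc.congr' ?_
    filter_upwards [eventually_pathMean_eq hk hf hM d, eventually_gt_atTop 0] with n h hn
    rw [h, hs n hn, mul_one]
  have hpair : Tendsto (fun n => pairMean f (pathExponent (d + 1)) n d) atTop (𝓝 0) := by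
    refine squeeze_zero' (Eventually.of_forall fun n => Finset.sum_nonneg fun _ _ =>
      Finset.sum_nonneg fun _ _ => measureReal_nonneg)
      (g := fun n => pairConst d * (M ^ (d + 1)) ^ 2 / (M * scale (d + 1) n)) ?_
      (Tendsto.const_div_atTop ((tendsto_scale hk).const_mul_atTop hM0) _)
    filter_upwards [eventually_pairMean_le hk hM0 hM d, eventually_gt_atTop 0] with n h hn
    rwa [hs n hn, mul_one] at h
  have hq := tendsto_div_rpow hk M
  have hup : Tendsto (fun n => Real.exp (-pathMean f (pathExponent (d + 1)) n d +
      pairMean f (pathExponent (d + 1)) n d)) atTop (𝓝 (Real.exp (-c))) := by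
    have := (Real.continuous_exp.tendsto _).comp (hmean.neg.add hpair)
    rwa [add_zero] at this
  have hlow : Tendsto (fun n : ℕ => Real.exp (-(pathMean f (pathExponent (d + 1)) n d /
      (1 - M / (n : ℝ) ^ pathExponent (d + 1))))) atTop (𝓝 (Real.exp (-c))) := by
    have h1 : Tendsto (fun n : ℕ => 1 - M / (n : ℝ) ^ pathExponent (d + 1)) atTop (𝓝 1) := by
      have := (tendsto_const_nhds (x := (1 : ℝ))).sub hq
      rwa [sub_zero] at this
    have h2 := (hmean.div h1 one_ne_zero).neg
    rw [div_one] at h2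
    exact (Real.continuous_exp.tendsto _).comp h2
  refine tendsto_of_tendsto_of_tendsto_of_le_of_le' hlow hup ?_
    (Eventually.of_forall fun n => noPathProb_le_exp)
  filter_upwards [hq.eventually_lt_const one_pos] with n h1
  exact exp_le_noPathProb (edgeProb_le hM0.le hM)
    (div_nonneg hM0.le (Real.rpow_nonneg (Nat.cast_nonneg n) _)) h1

/-- If `c_{k+1} > 0`, there is a path with `k + 1` edges, with probability tending to one. -/
lemma tendsto_noPathProb_succ (hk : 2 ≤ k) (hM0 : 0 < M)
    (hM : ∀ x ∈ Set.Ioc (0 : ℝ) 1, ∀ y ∈ Set.Ioc (0 : ℝ) 1, |f x y| ≤ M)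
    (hf : ∀ x ∈ Set.Icc (0 : ℝ) 1, ∀ y ∈ Set.Icc (0 : ℝ) 1, 0 ≤ f x y)
    {c : ℝ} (hc : Tendsto (fun n => pathSum f n k) atTop (𝓝 c)) (hc0 : 0 < c) :
    Tendsto (fun n => noPathProb f (pathExponent k) n (k + 1)) atTop (𝓝 0) := by
  -- The overlap bound is `C` times the scale `t` and the mean is `R t`, so Chebyshev gives `(R + C)
  -- / (R² t)`, which tends to `0` because `R` has a positive limit.
  set C := pairConst k * (M ^ (k + 1)) ^ 2 / M with hC
  have hlim : Tendsto (fun n => (pathSum f n k + C) / pathSum f n k ^ 2 * (scale k n)⁻¹) atTop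
      (𝓝 0) := by
    have h1 := ((hc.add_const C).div (hc.pow 2) (by positivity)).mul
      ((tendsto_inv_atTop_zero).comp (tendsto_scale hk))
    rwa [mul_zero] at h1
  refine squeeze_zero' (Eventually.of_forall fun n => measureReal_nonneg) ?_ hlim
  filter_upwards [eventually_pathMean_eq hk hf hM k, eventually_pairMean_le hk hM0 hM k,
    eventually_gt_atTop 0, hc.eventually_const_lt hc0] with n h1 h2 hn hR
  have ht := scale_pos (k := k) hn
  have hn' : (n : ℝ) ≠ 0 := by exact_mod_cast hn.ne'
  have hs : scale k n ^ (k + 1) / n = scale k n := by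
    rw [pow_succ, scale_pow hk]; field_simp
  rw [hs] at h1 h2
  have h3 : pairMean f (pathExponent k) n k ≤ C * scale k n := by
    refine h2.trans_eq ?_
    rw [hC]
    field_simp
  have h4 := noPathProb_mul_sq_le (f := f) (γ := pathExponent k) (n := n) (d := k)
  rw [h1] at h4
  set R := pathSum f n k
  set t := scale k n
  have h5 : noPathProb f (pathExponent k) n (k + 1) * (R ^ 2 * t) * t ≤ (R + C) * t := by
    calc _ = noPathProb f (pathExponent k) n (k + 1) * (R * t) ^ 2 := by ring
      _ ≤ _ := h4
      _ ≤ R * t + C * t := by linarith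
      _ = _ := by ring
  have h6 := le_of_mul_le_mul_right h5 ht
  rw [← div_eq_mul_inv, div_div, le_div_iff₀ (by positivity)]
  exact h6

end Asymptotics

/-- The path integrals of a positive function are positive. -/
lemma pathIntegral_pos {f : ℝ → ℝ → ℝ} (hf : ∀ x y : ℝ, 0 ≤ x → x < y → y ≤ 1 → 0 < f x y)
    {d : ℕ} (hint : IntegrableOn (pathProduct f d) (orderedSimplex d)) :
    0 < ∫ u in orderedSimplex d, pathProduct f d u := by
  have hpos : ∀ u ∈ orderedSimplex d, 0 < pathProduct f d u := fun u hu =>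
    Finset.prod_pos fun j _ => hf _ _ (addEnds_mem_Icc hu _).1 (hu Fin.castSucc_lt_succ)
      (addEnds_mem_Icc hu _).2
  have hm := measurableSet_orderedSimplex d
  rw [setIntegral_pos_iff_support_of_nonneg_ae
    ((ae_restrict_iff' hm).2 (Eventually.of_forall fun u hu => (hpos u hu).le)) hint,
    Set.inter_eq_right.2 fun u hu => Function.mem_support.2 (hpos u hu).ne']
  have hopen : IsOpen (orderedSimplex d) := by
    have : orderedSimplex d =
        ⋂ j : Fin (d + 1), {u | addEnds u j.castSucc < addEnds u j.succ} := by
      ext u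
      simp only [orderedSimplex, Set.mem_ofPred_eq, Fin.strictMono_iff_lt_succ, Set.mem_iInter]
    have hc : ∀ j : Fin (d + 2), Continuous fun u : Fin d → ℝ => addEnds u j := by
      intro j
      induction j using Fin.cases with
      | zero => exact continuous_const
      | succ j =>
        induction j using Fin.lastCases with
        | last => simp only [Fin.succ_last, addEnds_last]; exact continuous_const
        | cast a => simp only [addEnds_succ_castSucc]; exact continuous_apply a
    rw [this]
    exact isOpen_iInter_of_finite fun j => isOpen_lt (hc _) (hc _)
  -- Equally spaced points show that the open simplex is nonempty.
  refine hopen.measure_pos volume ⟨fun a => ((a : ℝ) + 1) / (d + 1), ?_⟩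
  have hd : (0 : ℝ) < d + 1 := by positivity
  have hval : ∀ j : Fin (d + 2),
      addEnds (fun a : Fin d => ((a : ℝ) + 1) / (d + 1)) j = (j : ℝ) / (d + 1) := by
    intro j
    induction j using Fin.cases with
    | zero => simp
    | succ j =>
      induction j using Fin.lastCases with
      | last =>
        rw [Fin.succ_last, addEnds_last, Fin.val_last, Nat.cast_succ, div_self hd.ne']
      | cast a => simp
  intro i j hij
  rw [hval, hval]
  have : (i : ℝ) < j := by exact_mod_cast hij
  exact div_lt_div_of_pos_right this hd

end BarakErdos

end

/-! ### Conclusion: squeezing the two probabilities -/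

theorem theorem1 (f : ℝ → ℝ → ℝ) (k : ℕ) (hk : 2 ≤ k)
    (hf0 : ∀ x ∈ Set.Icc (0 : ℝ) 1, ∀ y ∈ Set.Icc (0 : ℝ) 1, 0 ≤ f x y)
    (hfR : BarakErdos.RiemannIntegrable f)
    (hleft : ∀ᵐ t : ℝ ∂(volume.restrict (Set.Icc (0 : ℝ) 1)),
      ContinuousWithinAt (fun p : ℝ × ℝ => f p.1 p.2)
        (Set.Icc (0 : ℝ) 1 ×ˢ Set.Icc (0 : ℝ) 1) (0, t))
    (hright : ∀ᵐ t : ℝ ∂(volume.restrict (Set.Icc (0 : ℝ) 1)),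
      ContinuousWithinAt (fun s : ℝ => f s 1) (Set.Icc (0 : ℝ) 1) t) :
    IntegrableOn (BarakErdos.pathProduct f (k - 1)) (BarakErdos.orderedSimplex (k - 1)) volume ∧
    Tendsto (fun n : ℕ => BarakErdos.probLength f (1 - 1 / (k : ℝ)) n k) atTop
      (𝓝 (1 - Real.exp (-BarakErdos.pathIntegral f k))) ∧
    (0 < BarakErdos.pathIntegral f (k + 1) →
      Tendsto (fun n : ℕ => BarakErdos.probLength f (1 - 1 / (k : ℝ)) n (k + 1)) atTop
        (𝓝 (Real.exp (-BarakErdos.pathIntegral f k)))) ∧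
    ((∀ x y : ℝ, 0 ≤ x → x < y → y ≤ 1 → 0 < f x y) →
      0 < BarakErdos.pathIntegral f (k + 1)) := by
  obtain ⟨M', hM'⟩ := BarakErdos.bounded_of_riemannIntegrable hfR
  -- A bound on the half-open square is enough, since grid points `i / n` with `i ≥ 1` avoid `0`.
  -- The maximum with `1` makes it positive, so that `M * scale` tends to infinity.
  have hM : ∀ x ∈ Set.Ioc (0 : ℝ) 1, ∀ y ∈ Set.Ioc (0 : ℝ) 1, |f x y| ≤ max M' 1 := by
    intro x hx y hy
    refine le_trans ?_ (le_max_left _ _)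
    refine hM' ![x, y] fun i => ?_
    fin_cases i
    · exact hx
    · exact hy
  have hM0 : 0 < max M' 1 := lt_max_of_lt_right one_pos
  have hlim := BarakErdos.tendsto_sum_gridProduct hM
    (BarakErdos.ae_continuousAt_of_riemannIntegrable hfR) hleft hright
  -- A path with `k` edges has `k - 1 = (k - 2) + 1` interior vertices; `k ≥ 2` ensures there is at
  -- least one.
  have hk1 := hlim (k - 2)
  have hk2 := hlim (k - 1)
  rw [show k - 2 + 1 = k - 1 by omega] at hk1
  rw [show k - 1 + 1 = k by omega] at hk2
  have hno := BarakErdos.tendsto_noPathProb hk hM0 hM hf0 hk1.2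
  have hshort : Tendsto (fun n => ∑ j ∈ Finset.range k,
      (1 - BarakErdos.noPathProb f (BarakErdos.pathExponent k) n j)) atTop (𝓝 0) := by
    have := tendsto_finsetSum (Finset.range k) fun j hj =>
      BarakErdos.tendsto_one_sub_noPathProb_of_lt hk hM0 hM (Finset.mem_range.1 hj)
    simpa using this
  refine ⟨hk1.1, ?_, fun hpos => ?_, fun hpos => ?_⟩
  · have h1 := tendsto_const_nhds (x := (1 : ℝ)).sub hno
    have h2 := h1.sub hshort
    rw [sub_zero] at h2
    refine tendsto_of_tendsto_of_tendsto_of_le_of_le h2 h1 (fun n => ?_)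
      fun n => BarakErdos.probLength_le_one_sub n k
    exact sub_le_iff_le_add.2 (BarakErdos.one_sub_le_probLength_add n k)
  · have hsucc := BarakErdos.tendsto_noPathProb_succ hk hM0 hM hf0 hk2.2 hpos
    have h2 := hno.sub (hshort.add hsucc)
    rw [add_zero, sub_zero] at h2
    refine tendsto_of_tendsto_of_tendsto_of_le_of_le h2 hno (fun n => ?_)
      fun n => BarakErdos.probLength_succ_le n k
    exact sub_le_iff_le_add.2 (BarakErdos.noPathProb_le_probLength_succ_add n k)
  · exact BarakErdos.pathIntegral_pos hpos hk2.1
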